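/- Let $0<q<1$ and $[k]=\frac{1-q^k}{1-q}$ for integers $k\ge 1$. For $r\ge 1$ let $$U_r=\{(s_1,\dots,s_r)\in\mathbb{C}^r : \operatorname{Re}(s_1+\dots+s_j)>0 \text{ for } j=1,\dots,r\},$$ and let the $q$-multiple zeta-star function of depth $r$ be defined on $U_r$ by the absolutely convergent series $$\zeta_q^{\star}(s_1,\dots,s_r)=\sum_{k_1\ge\dots\ge k_r\ge 1}\frac{q^{k_1s_1+\dots+k_rs_r}}{[k_1]^{s_1}\cdots[k_r]^{s_r}} .$$ Then for every $r\ge1$ the function $\zeta_q^{\star}$ is holomorphic on $U_r$ and extends to a meromorphic function on $\mathbb{C}^r$ (locally a quotient of holomorphic functions), again denoted $\zeta_q^{\star}$. For every $r\ge 2$ the extended functions satisfy the translation formula $$\zeta_q^{\star}(s_1+s_2,s_3,\dots,s_r)=q^{s_1}\sum_{k\ge0}(-1)^k\frac{s_1(s_1+1)\cdots(s_1+k)}{(k+1)!}\,\zeta_q^{\star}(s_1+k+1,s_2,\dots,s_r)+(1-q^{s_1})\,\zeta_q^{\star}(s_1,\dots,s_r)$$ on $\mathbb{C}^r$: at every point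 $(s_1,\dots,s_r)\in\mathbb{C}^r$ such that $\zeta_q^\star$ of depth $r-1$ is holomorphic at $(s_1+s_2,s_3,\dots,s_r)$ and $\zeta_q^\star$ of depth $r$ is holomorphic at $(s_1,\dots,s_r)$ and at $(s_1+k+1,s_2,\dots,s_r)$ for all $k\ge0$ (in particular at every point of $U_r$), the series on the right-hand side converges and the formula holds. Moreover the series on the right-hand side converges normally on every compact subset of $U_r$: on such a set, the suprema of the absolute values of its terms form a convergent series. -/

import Mathlib

namespace QZetaStar

noncomputable section

/-- The `q`-analogue `[k] = (1 - q ^ k) / (1 - q)` of the natural number `k`. -/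
def qNat (q : ℝ) (k : ℕ) : ℝ := (1 - q ^ k) / (1 - q)

/-- The tuples `k₁ ≥ k₂ ≥ ⋯ ≥ k_r ≥ 1` of natural numbers. -/
def StarIndex (r : ℕ) : Type := {k : Fin r → ℕ // Antitone k ∧ ∀ i, 1 ≤ k i}

/-- The summand `q ^ (k₁ s₁ + ⋯ + k_r s_r) / ([k₁] ^ s₁ ⋯ [k_r] ^ s_r)`. For `0 < q < 1` and
positive `k i`, all bases are positive reals. -/
def starTerm (q : ℝ) {r : ℕ} (s : Fin r → ℂ) (k : Fin r → ℕ) : ℂ :=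
  (q : ℂ) ^ (∑ i, (k i : ℂ) * s i) / ∏ i, ((qNat q (k i) : ℝ) : ℂ) ^ s i

/-- The `q`-multiple zeta-star function, as the sum of its defining series. -/
def zetaStar (q : ℝ) {r : ℕ} (s : Fin r → ℂ) : ℂ := ∑' k : StarIndex r, starTerm q s k.1

/-- The domain `U_r`: `Re (s₁ + ⋯ + s_j) > 0` for `j = 1, …, r`. -/
def U (r : ℕ) : Set (Fin r → ℂ) := {s | ∀ j : Fin r, 0 < (∑ i ∈ Finset.Iic j, s i).re}

/-- `F` is a meromorphic function on `ℂ^r`: near every point it is a quotient `g / h` of two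
holomorphic functions, where `h` does not vanish identically near that point. As usual in Lean,
`F` is a total function, and its values on the zero set of `h` are not constrained. -/
def IsMeromorphic {r : ℕ} (F : (Fin r → ℂ) → ℂ) : Prop :=
  ∀ z, ∃ g h : (Fin r → ℂ) → ℂ, AnalyticAt ℂ g z ∧ AnalyticAt ℂ h z ∧
    (¬ ∀ᶠ w in nhds z, h w = 0) ∧ ∀ᶠ w in nhds z, h w ≠ 0 → F w = g w / h w

/-- `(s₁, …, s_r) ↦ (s₁ + s₂, s₃, …, s_r)`. -/
def merge {n : ℕ} (s : Fin (n + 2) → ℂ) : Fin (n + 1) → ℂ :=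
  Fin.cons (s 0 + s 1) (fun i : Fin n => s i.succ.succ)

/-- `(s₁, …, s_r) ↦ (s₁ + k + 1, s₂, …, s_r)`. -/
def shift {n : ℕ} (s : Fin (n + 1) → ℂ) (k : ℕ) : Fin (n + 1) → ℂ :=
  Function.update s 0 (s 0 + k + 1)

/-- `(-1) ^ k * s (s + 1) ⋯ (s + k) / (k + 1)!`. -/
def coeff (s : ℂ) (k : ℕ) : ℂ :=
  (-1) ^ k * (∏ i ∈ Finset.range (k + 1), (s + i)) / ((k + 1).factorial : ℂ)

/-- The series `∑ₖ f k` converges normally on `K`: the suprema of the `‖f k‖` on `K` are finite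
and dominated by the terms of a convergent series. -/
def NormallyConvergentOn {α : Type*} (f : ℕ → α → ℂ) (K : Set α) : Prop :=
  ∃ u : ℕ → ℝ, Summable u ∧ ∀ k, ∀ s ∈ K, ‖f k s‖ ≤ u k

end

end QZetaStar

namespace QZetaStar

/-! ### Holomorphy in several variables: Cauchy's formula on polydiscs and Osgood's lemma. -/

section SeveralVariables

open Complex MeasureTheory Metric Function

/-! On `U r`, expand each factor (1 - q^{k_i})^{-s_i} into a binomial series with exponent n_i, and
write the tuple k through its successive differences m_j. Each m_j then runs over a geometric
series. Exchanging the absolutely convergent sums leaves (1-q)^{Σ s_i} Σ_n Π_i rising(s_i, n_i) ·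
q^{Σ (s_i + n_i)} · Π_j 1/(1 - q^{s_1+…+s_j+n_1+…+n_j}). This series, `extension`, converges
absolutely at every s (with 1/0 read as 0). Near a given point, multiplying by finitely many factors
1 - q^{s_1+…+s_j+N} clears its poles, and Osgood's lemma makes the cleared series analytic; hence
the meromorphic continuation.

For the translation formula, let T(n) be the summand above. Shifting s_1 by k+1 amounts to shifting
n_1 by k+1, up to a binomial coefficient and a power of 1-q, so the binomial theorem turns the
series on the right into Σ (1 - q^{n_1}) T(n) (`tsum_coeff_mul_extension_shift`). The whole
right-hand side is therefore Σ (1 - q^{s_1+n_1}) T(n). The new factor cancels the denominator for j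
= 1; n_1 and n_2 then enter separately only through two rising factorials, which Vandermonde's
identity merges into that of s_1 + s_2 (`extension_merge`). The cancellation fails only where
q^{s_1+a} = 1 for some natural a; such points are limits of good ones along (s_1+t, s_2-t, s_3, …),
a line on which the left-hand side is constant (`translation`). -/

theorem torusMap_mem_closedBall {r : ℕ} (c : Fin r → ℂ) {R : ℝ} (hR : 0 ≤ R) (θ : Fin r → ℝ) :
    torusMap c (fun _ => R) θ ∈ closedBall c R := by
  rw [mem_closedBall, dist_pi_le_iff hR]
  intro i
  simp [torusMap, dist_eq_norm, Complex.norm_exp, abs_of_nonneg hR]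

theorem torusMap_sub_ne_zero {r : ℕ} {c w : Fin r → ℂ} {R : ℝ} (hw : w ∈ ball c R)
    (θ : Fin r → ℝ) (i : Fin r) : torusMap c (fun _ => R) θ i - w i ≠ 0 := by
  have hR : 0 < R := pos_of_mem_ball hw
  intro h
  have h1 : dist (w i) (c i) < R := (dist_le_pi_dist w c i).trans_lt hw
  rw [← sub_eq_zero.1 h, dist_eq_norm] at h1
  simp [torusMap, Complex.norm_exp, abs_of_pos hR] at h1

theorem continuous_torusMap {r : ℕ} (c : Fin r → ℂ) (R : Fin r → ℝ) :
    Continuous (torusMap c R) := by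
  unfold torusMap
  fun_prop

/-- The Cauchy integral formula on a polydisc, for continuous functions that are holomorphic in
each variable. -/
theorem torusIntegral_prod_sub_inv_smul {r : ℕ} {f : (Fin r → ℂ) → ℂ} {c w : Fin r → ℂ} {R : ℝ}
    (hc : ContinuousOn f (closedBall c R))
    (hd : ∀ z ∈ closedBall c R, ∀ i,
      DifferentiableOn ℂ (fun t => f (update z i t)) (closedBall (c i) R))
    (hw : w ∈ ball c R) (hR : 0 < R) :
    torusIntegral (fun z => (∏ i, (z i - w i)⁻¹) • f z) c (fun _ => R) =
      (2 * Real.pi * I) ^ r * f w := by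
  induction r with
  | zero =>
    rw [torusIntegral_dim0, Subsingleton.elim c w]
    simp
  | succ r ih =>
    have hint : TorusIntegrable (fun z => (∏ i, (z i - w i)⁻¹) • f z) c (fun _ => R) := by
      refine ContinuousOn.integrableOn_compact isCompact_Icc (ContinuousOn.fun_smul ?_ ?_)
      · refine continuousOn_finsetProd _ fun i _ => ContinuousOn.inv₀ ?_ ?_
        · exact ((continuous_pi_iff.1 (continuous_torusMap c _) i).fun_sub
            continuous_const).continuousOn
        · intro θ _
          exact torusMap_sub_ne_zero hw θ i
      · exact hc.comp (continuous_torusMap c _).continuousOn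
          fun θ _ => torusMap_mem_closedBall c hR.le θ
    have hball : ∀ (x : ℂ) (y : Fin r → ℂ), x ∈ closedBall (c 0) R →
        y ∈ closedBall (c ∘ Fin.succ) R → (Fin.cons x y : Fin (r + 1) → ℂ) ∈ closedBall c R := by
      intro x y hx hy
      rw [mem_closedBall, dist_pi_le_iff hR.le] at hy ⊢
      intro i
      refine Fin.cases ?_ (fun j => ?_) i
      · simpa using hx
      · simpa using hy j
    have hw0 : w 0 ∈ ball (c 0) R := (dist_le_pi_dist w c 0).trans_lt hw
    have hw1 : w ∘ Fin.succ ∈ ball (c ∘ Fin.succ) R := by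
      rw [mem_ball, dist_pi_lt_iff hR]
      exact fun i => (dist_le_pi_dist w c i.succ).trans_lt hw
    rw [torusIntegral_succ hint]
    -- With the first variable frozen on its circle, the induction hypothesis evaluates the inner
    -- integral; the one-variable Cauchy formula then finishes.
    have hinner : ∀ x ∈ sphere (c 0) R,
        torusIntegral (fun y : Fin r → ℂ => (∏ i, ((Fin.cons x y : Fin (r + 1) → ℂ) i - w i)⁻¹) •
          f (Fin.cons x y)) (c ∘ Fin.succ) ((fun _ => R) ∘ Fin.succ) =
        (2 * Real.pi * I) ^ r * ((x - w 0)⁻¹ • f (Fin.cons x (w ∘ Fin.succ))) := by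
      intro x hx
      have hx' := sphere_subset_closedBall hx
      have := ih (f := fun y => f (Fin.cons x y)) (c := c ∘ Fin.succ) (w := w ∘ Fin.succ)
        (hc.comp (by fun_prop) fun y hy => hball x y hx' hy)
        (fun y hy i => by
          have := hd _ (hball x y hx' hy) i.succ
          simpa only [Fin.cons_update, comp_apply] using this) hw1
      simp only [Fin.prod_univ_succ, Fin.cons_zero, Fin.cons_succ, mul_smul]
      rw [torusIntegral_smul]
      simp only [comp_apply, smul_eq_mul] at this ⊢
      rw [show ((fun _ : Fin (r + 1) => R) ∘ Fin.succ) = fun _ => R from rfl, this]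
      ring
    rw [circleIntegral.integral_congr hR.le hinner]
    have h1 : DifferentiableOn ℂ (fun x => f (Fin.cons x (w ∘ Fin.succ))) (closedBall (c 0) R) := by
      have := hd w (ball_subset_closedBall hw) 0
      refine this.congr fun x _ => ?_
      congr 1
      rw [← Fin.cons_self_tail w, Fin.update_cons_zero]
      rfl
    simp only [← smul_eq_mul (a := (2 * Real.pi * I) ^ r)]
    rw [circleIntegral.integral_smul, h1.circleIntegral_sub_inv_smul hw0]
    have : (Fin.cons (w 0) (w ∘ Fin.succ) : Fin (r + 1) → ℂ) = w := Fin.cons_self_tail w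
    rw [this, smul_eq_mul, smul_eq_mul]
    ring

/-- Osgood's lemma: a continuous function that is holomorphic in each variable is analytic. -/
theorem analyticAt_of_continuousOn_of_separately {r : ℕ} {f : (Fin r → ℂ) → ℂ} {c : Fin r → ℂ}
    {R : ℝ} (hR : 0 < R) (hc : ContinuousOn f (closedBall c R))
    (hd : ∀ z ∈ closedBall c R, ∀ i,
      DifferentiableOn ℂ (fun t => f (update z i t)) (closedBall (c i) R)) :
    AnalyticAt ℂ f c := by
  -- Cauchy's formula exhibits f(w) as a continuous linear functional applied to the kernel `k w` in
  -- the Banach algebra `C(K, ℂ)`. The kernel is analytic in w because inversion is analytic at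
  -- units, so no power series has to be computed.
  let K := Set.Icc (0 : Fin r → ℝ) fun _ => 2 * Real.pi
  have : CompactSpace K := isCompact_iff_compactSpace.1 isCompact_Icc
  let μ : Measure K := Measure.comap Subtype.val volume
  have : IsFiniteMeasure μ := by
    refine ⟨?_⟩
    rw [comap_subtype_coe_apply measurableSet_Icc, Set.image_univ, Subtype.range_coe]
    exact isCompact_Icc.measure_lt_top
  let Φ : C(K, ℂ) := ⟨fun θ => (∏ i, R * exp (θ.1 i * I) * I) * f (torusMap c (fun _ => R) θ.1), by
    refine Continuous.fun_mul ((by fun_prop :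
      Continuous fun θ : Fin r → ℝ => ∏ i, (R : ℂ) * exp (θ i * I) * I).comp
        continuous_subtype_val) ?_
    exact hc.comp_continuous ((continuous_torusMap c _).comp continuous_subtype_val)
      fun θ => torusMap_mem_closedBall c hR.le θ.1⟩
  let T : Fin r → C(K, ℂ) := fun i => ⟨fun θ => torusMap c (fun _ => R) θ.1 i, by
    exact (continuous_pi_iff.1 (continuous_torusMap c fun _ => R) i).comp continuous_subtype_val⟩
  let k : (Fin r → ℂ) → C(K, ℂ) := fun w => ∏ i, Ring.inverse (T i - algebraMap ℂ C(K, ℂ) (w i))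
  have hunit : ∀ w ∈ ball c R, ∀ i, IsUnit (T i - algebraMap ℂ C(K, ℂ) (w i)) := by
    intro w hw i
    rw [ContinuousMap.isUnit_iff_forall_ne_zero]
    intro θ
    exact torusMap_sub_ne_zero hw θ.1 i
  have hk : AnalyticAt ℂ k c := by
    refine Finset.analyticAt_fun_prod _ fun i _ => ?_
    have h1 : AnalyticAt ℂ (fun w : Fin r → ℂ => T i - algebraMap ℂ C(K, ℂ) (w i)) c := by
      refine analyticAt_const.sub ?_
      exact ((Algebra.linearMap ℂ C(K, ℂ)).toContinuousLinearMap.comp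
        (ContinuousLinearMap.proj (R := ℂ) (φ := fun _ : Fin r => ℂ) i)).analyticAt c
    obtain ⟨u, hu⟩ := hunit c (mem_ball_self hR) i
    have h2 : AnalyticAt ℂ (Ring.inverse : C(K, ℂ) → C(K, ℂ))
        (T i - algebraMap ℂ C(K, ℂ) (c i)) := hu ▸ analyticAt_inverse u
    exact AnalyticAt.fun_comp (f := fun w : Fin r → ℂ => T i - algebraMap ℂ C(K, ℂ) (w i)) h2 h1
  let L : C(K, ℂ) →ₗ[ℂ] ℂ :=
    { toFun := fun g => ∫ θ, Φ θ * g θ ∂μ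
      map_add' := fun g h => by
        simp only [ContinuousMap.add_apply, mul_add]
        exact integral_add ((Φ * g).continuous.integrable_of_hasCompactSupport
          (HasCompactSupport.of_compactSpace _)) ((Φ * h).continuous.integrable_of_hasCompactSupport
          (HasCompactSupport.of_compactSpace _))
      map_smul' := fun a g => by
        simp only [ContinuousMap.smul_apply, smul_eq_mul, RingHom.id_apply, mul_left_comm _ a]
        exact integral_const_mul _ _ }
  let L' : C(K, ℂ) →L[ℂ] ℂ := L.mkContinuous (‖Φ‖ * μ.real Set.univ) fun g => by
    have := norm_integral_le_of_norm_le_const (μ := μ) (f := fun θ => Φ θ * g θ)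
      (C := ‖Φ‖ * ‖g‖) (Filter.Eventually.of_forall fun θ => by
        rw [norm_mul]
        gcongr
        · exact Φ.norm_coe_le_norm θ
        · exact g.norm_coe_le_norm θ)
    refine this.trans (le_of_eq ?_)
    ring
  have key : ∀ w ∈ ball c R, f w = ((2 * Real.pi * I) ^ r)⁻¹ * L' (k w) := by
    intro w hw
    have hne : (2 * Real.pi * I : ℂ) ^ r ≠ 0 := pow_ne_zero _ (by simp [Real.pi_ne_zero])
    rw [eq_inv_mul_iff_mul_eq₀ hne, ← torusIntegral_prod_sub_inv_smul hc hd hw hR]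
    change torusIntegral _ _ _ = ∫ θ, Φ θ * k w θ ∂μ
    rw [torusIntegral, ← integral_subtype_comap measurableSet_Icc]
    refine integral_congr_ae (Filter.Eventually.of_forall fun θ => ?_)
    have hk' : k w θ = ∏ i, (torusMap c (fun _ => R) θ.1 i - w i)⁻¹ := by
      rw [ContinuousMap.prod_apply]
      refine Finset.prod_congr rfl fun i _ => ?_
      have h1 : Ring.inverse (T i - algebraMap ℂ C(K, ℂ) (w i)) θ *
          (T i - algebraMap ℂ C(K, ℂ) (w i)) θ = 1 := by
        rw [← ContinuousMap.mul_apply, Ring.inverse_mul_cancel _ (hunit w hw i)]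
        rfl
      exact eq_inv_of_mul_eq_one_left h1
    simp only [hk', smul_eq_mul]
    change _ = (∏ i, (R : ℂ) * exp (θ.1 i * I) * I) * f (torusMap c (fun _ => R) θ.1) * _
    ring
  have h3 : AnalyticAt ℂ (fun w => ((2 * Real.pi * I) ^ r)⁻¹ * L' (k w)) c :=
    analyticAt_const.mul ((L'.analyticAt _).comp hk)
  exact h3.congr (Filter.eventually_of_mem (ball_mem_nhds c hR) fun w hw => (key w hw).symm)

/-- A series of holomorphic functions that is dominated on a ball has an analytic sum. -/
theorem analyticAt_tsum_of_summable_norm {ι : Type*} {r : ℕ} {F : ι → (Fin r → ℂ) → ℂ}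
    {c : Fin r → ℂ} {R : ℝ} (hR : 0 < R) {u : ι → ℝ} (hu : Summable u)
    (hF : ∀ n, DifferentiableOn ℂ (F n) (ball c R))
    (hb : ∀ n, ∀ w ∈ ball c R, ‖F n w‖ ≤ u n) :
    AnalyticAt ℂ (fun w => ∑' n, F n w) c := by
  -- The one-variable theorem on series needs an open set, Osgood's lemma a closed ball; halving the
  -- radius reconciles them.
  have hsub : closedBall c (R / 2) ⊆ ball c R := closedBall_subset_ball (by linarith)
  refine analyticAt_of_continuousOn_of_separately (half_pos hR) ?_ ?_
  · exact continuousOn_tsum (fun n => (hF n).continuousOn.mono hsub) hu fun n w hw => hb n w (hsub hw)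
  · intro z hz i
    have hmem : ∀ t ∈ ball (c i) R, update z i t ∈ ball c R := by
      intro t ht
      rw [mem_ball, dist_pi_lt_iff hR]
      intro j
      by_cases hj : j = i
      · subst hj; simpa using ht
      · simpa [hj] using (dist_le_pi_dist z c j).trans_lt (hsub hz)
    refine (differentiableOn_tsum_of_summable_norm hu (fun n => ?_) isOpen_ball
      fun n t ht => hb n _ (hmem t ht)).mono (closedBall_subset_ball (by linarith))
    exact (hF n).comp (fun t _ => (hasFDerivAt_update z t).differentiableAt.differentiableWithinAt)
      hmem

end SeveralVariables

/-! ### Normalized rising factorials and the binomial series. -/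

section Rising

/-- The normalized rising factorial `s (s + 1) ⋯ (s + n - 1) / n!`. -/
noncomputable def rising {K : Type*} [Field K] (s : K) (n : ℕ) : K :=
  (∏ i ∈ Finset.range n, (s + i)) / (n.factorial : K)

theorem coeff_eq_rising (s : ℂ) (k : ℕ) : coeff s k = (-1) ^ k * rising s (k + 1) :=
  mul_div_assoc _ _ _

theorem rising_nonneg {R : ℝ} (hR : 0 ≤ R) (n : ℕ) : 0 ≤ rising R n :=
  div_nonneg (Finset.prod_nonneg fun i _ => by positivity) (by positivity)

theorem norm_rising_le {s : ℂ} {R : ℝ} (h : ‖s‖ ≤ R) (n : ℕ) : ‖rising s n‖ ≤ rising R n := by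
  simp only [rising, norm_div, norm_prod, RCLike.norm_natCast]
  gcongr with i _
  exact (norm_add_le _ _).trans (by simpa using h)

theorem rising_eq_choose {K : Type*} [Field K] [CharZero K] (s : K) (n : ℕ) :
    rising s n = Ring.choose (s + n - 1) n := by
  rw [← Ring.multichoose_eq, rising, div_eq_iff (by exact_mod_cast n.factorial_ne_zero), mul_comm,
    ← nsmul_eq_mul, Ring.factorial_nsmul_multichoose_eq_ascPochhammer,
    Polynomial.ascPochhammer_smeval_eq_eval]
  induction n with
  | zero => simp
  | succ n ih => rw [Finset.prod_range_succ, ih, ascPochhammer_succ_eval]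

theorem choose_neg_eq_rising {K : Type*} [Field K] [CharZero K] (s : K) (n : ℕ) :
    Ring.choose (-s) n = (-1) ^ n * rising s n := by
  rw [Ring.choose_neg, rising_eq_choose]
  rcases Nat.even_or_odd n with h | h <;> simp [Int.negOnePow, h, Units.smul_def]

/-- Vandermonde's identity for the generalized binomial coefficients at -s and -t, with the signs
removed. -/
theorem sum_antidiagonal_rising {K : Type*} [Field K] [CharZero K] (s t : K) (n : ℕ) :
    ∑ x ∈ Finset.HasAntidiagonal.antidiagonal n, rising s x.1 * rising t x.2 = rising (s + t) n := by
  have h := Ring.add_choose_eq n (Commute.all (-s) (-t))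
  rw [← neg_add, choose_neg_eq_rising] at h
  have h2 : ((-1 : K) ^ n) * (-1) ^ n = 1 := by rw [← mul_pow]; simp
  rw [← one_mul (rising (s + t) n), ← h2, mul_assoc, h, Finset.mul_sum]
  refine Finset.sum_congr rfl fun x hx => ?_
  rw [choose_neg_eq_rising, choose_neg_eq_rising, ← Finset.HasAntidiagonal.mem_antidiagonal.1 hx, pow_add]
  have h3 (m : ℕ) : ((-1 : K) ^ m) * (-1) ^ m = 1 := by rw [← mul_pow]; simp
  linear_combination (-(rising s x.1 * rising t x.2)) * (h3 x.1) * (-1 : K) ^ x.2 * (-1) ^ x.2 -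
    (rising s x.1 * rising t x.2) * h3 x.2

theorem rising_mul_rising_add {K : Type*} [Field K] [CharZero K] (s : K) (m n : ℕ) :
    rising s m * rising (s + m) n = (m + n).choose m * rising s (m + n) := by
  have h : ((m + n).choose m : K) * m.factorial * n.factorial = (m + n).factorial := by
    have := Nat.choose_mul_factorial_mul_factorial (Nat.le_add_right m n)
    rw [Nat.add_sub_cancel_left] at this
    exact_mod_cast this
  have hm : (m.factorial : K) ≠ 0 := by exact_mod_cast m.factorial_ne_zero
  have hn : (n.factorial : K) ≠ 0 := by exact_mod_cast n.factorial_ne_zero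
  have hmn : ((m + n).factorial : K) ≠ 0 := by exact_mod_cast (m + n).factorial_ne_zero
  simp only [rising, Finset.prod_range_add]
  push_cast
  simp only [add_assoc]
  rw [div_mul_div_comm, mul_div_assoc', div_eq_div_iff (mul_ne_zero hm hn) hmn, ← h]
  ring

theorem hasSum_rising_mul_pow (s : ℂ) {x : ℝ} (hx0 : 0 ≤ x) (hx : x < 1) :
    HasSum (fun n => rising s n * (x : ℂ) ^ n) ((((1 - x : ℝ) : ℂ) ^ s)⁻¹) := by
  have h := (Complex.one_div_one_sub_cpow_hasFPowerSeriesOnBall_zero s).hasSum (y := (x : ℂ))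
    (by simpa [enorm_eq_nnnorm, ← NNReal.coe_lt_coe, abs_of_nonneg hx0] using hx)
  simpa [rising_eq_choose, mul_comm] using h

theorem hasSum_real_rising_mul_pow (R : ℝ) {x : ℝ} (hx0 : 0 ≤ x) (hx : x < 1) :
    HasSum (fun n => rising R n * x ^ n) (((1 - x) ^ R)⁻¹) := by
  have h := (Real.one_div_one_sub_rpow_hasFPowerSeriesOnBall_zero R).hasSum (y := x)
    (by simpa [enorm_eq_nnnorm, ← NNReal.coe_lt_coe, abs_of_nonneg hx0] using hx)
  simpa [rising_eq_choose, mul_comm] using h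

theorem differentiable_rising (n : ℕ) : Differentiable ℂ fun s : ℂ => rising s n := by
  unfold rising
  fun_prop

end Rising

/-! ### Products of series as sums over tuples. -/

section ProductSums

/-- Prepending an entry to a tuple of natural numbers. -/
def consNat (r : ℕ) : ℕ × (Fin r → ℕ) ≃ (Fin (r + 1) → ℕ) := Fin.consEquiv fun _ => ℕ

theorem consNat_apply {r : ℕ} (p : ℕ × (Fin r → ℕ)) : consNat r p = Fin.cons p.1 p.2 := rfl

/-- Distributivity of a finite product over absolutely convergent series. -/
theorem hasSum_pi_prod {𝕜 : Type*} [NormedField 𝕜] [CompleteSpace 𝕜] {r : ℕ} {f : Fin r → ℕ → 𝕜}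
    (hf : ∀ i, Summable fun n => ‖f i n‖) :
    (Summable fun n : Fin r → ℕ => ‖∏ i, f i (n i)‖) ∧
      HasSum (fun n : Fin r → ℕ => ∏ i, f i (n i)) (∏ i, ∑' m, f i m) := by
  induction r with
  | zero => exact ⟨Summable.of_finite, by simp⟩
  | succ r ih =>
    obtain ⟨h1, h2⟩ := ih fun i => hf i.succ
    have he (p : ℕ × (Fin r → ℕ)) :
        ∏ i, f i (consNat r p i) = f 0 p.1 * ∏ i : Fin r, f i.succ (p.2 i) := by
      simp [Fin.prod_univ_succ, consNat_apply]
    have hs : Summable fun p : ℕ × (Fin r → ℕ) => ‖f 0 p.1 * ∏ i : Fin r, f i.succ (p.2 i)‖ :=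
      Summable.mul_norm (f := f 0) (g := fun n : Fin r → ℕ => ∏ i : Fin r, f i.succ (n i)) (hf 0) h1
    refine ⟨?_, ?_⟩
    · rw [← (consNat r).summable_iff]
      simp only [Function.comp_def, he]
      exact hs
    · rw [← (consNat r).hasSum_iff, Fin.prod_univ_succ, ← h2.tsum_eq,
        tsum_mul_tsum_of_summable_norm (hf 0) h1]
      simp only [Function.comp_def, he]
      exact hs.of_norm.hasSum

theorem summable_pi_prod {r : ℕ} {f : Fin r → ℕ → ℝ} (hf : ∀ i, Summable (f i)) :
    Summable fun n : Fin r → ℕ => ∏ i, f i (n i) :=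
  (hasSum_pi_prod fun i => (hf i).norm).2.summable

end ProductSums

/-! ### The meromorphic continuation. -/

section Continuation

open Filter Topology

/-- The partial sum `s₁ + ⋯ + s_j`. -/
def pSum {A : Type*} [AddCommMonoid A] {r : ℕ} (s : Fin r → A) (j : Fin r) : A :=
  ∑ i ∈ Finset.Iic j, s i

theorem pSum_add_natCast {r : ℕ} (s : Fin r → ℂ) (n : Fin r → ℕ) (j : Fin r) :
    pSum (fun i => s i + (n i : ℂ)) j = pSum s j + (pSum n j : ℕ) := by
  simp [pSum, Finset.sum_add_distrib]

theorem differentiable_pSum {r : ℕ} (j : Fin r) :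
    Differentiable ℂ fun s : Fin r → ℂ => pSum s j := by
  unfold pSum
  fun_prop

/-- The summand of the series obtained by expanding each `(1 - q ^ k) ^ (-s)` into powers of
`q ^ k`, with arbitrary coefficients `e j N` in place of `1 / (1 - q ^ (s₁ + ⋯ + s_j + N))`. -/
noncomputable def expansionTerm (q : ℝ) {r : ℕ} (s : Fin r → ℂ) (e : Fin r → ℕ → ℂ)
    (n : Fin r → ℕ) : ℂ :=
  ((1 - q : ℝ) : ℂ) ^ (∑ i, s i) * (∏ i, rising (s i) (n i)) *
    ((q : ℂ) ^ (∑ i, (s i + n i)) * ∏ j, e j (pSum n j))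

/-- The coefficient `1 / (1 - q ^ (s₁ + ⋯ + s_j + N))`. -/
noncomputable def geomCoeff (q : ℝ) {r : ℕ} (s : Fin r → ℂ) (j : Fin r) (N : ℕ) : ℂ :=
  (1 - (q : ℂ) ^ (pSum s j + N))⁻¹

/-- The meromorphic continuation of the `q`-multiple zeta-star function. -/
noncomputable def extension (q : ℝ) {r : ℕ} (s : Fin r → ℂ) : ℂ :=
  ∑' n : Fin r → ℕ, expansionTerm q s (geomCoeff q s) n

variable {q : ℝ}

/-- The coefficients are kept arbitrary so that one bound serves the geometric coefficients, their
pole-free multiples and the constant 1. The radii may differ by coordinate because the translation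
enlarges only the first. -/
theorem norm_expansionTerm_le (hq0 : 0 < q) (hq1 : q < 1) {r : ℕ} {s : Fin r → ℂ} {R : Fin r → ℝ}
    {e : Fin r → ℕ → ℂ} {D : ℝ} (hs : ∀ i, ‖s i‖ ≤ R i) (he : ∀ j N, ‖e j N‖ ≤ D)
    (n : Fin r → ℕ) :
    ‖expansionTerm q s e n‖ ≤
      (1 - q) ^ (∑ i, s i).re * q ^ (∑ i, s i).re * D ^ r * ∏ i, rising (R i) (n i) * q ^ n i := by
  have h1 : ‖((1 - q : ℝ) : ℂ) ^ (∑ i, s i)‖ = (1 - q) ^ (∑ i, s i).re :=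
    Complex.norm_cpow_eq_rpow_re_of_pos (sub_pos.2 hq1) _
  have h2 : ‖(q : ℂ) ^ (∑ i, (s i + n i))‖ = q ^ (∑ i, s i).re * ∏ i, q ^ n i := by
    rw [Complex.norm_cpow_eq_rpow_re_of_pos hq0, Finset.sum_add_distrib, Complex.add_re,
      Real.rpow_add hq0, Finset.prod_pow_eq_pow_sum, ← Real.rpow_natCast]
    simp
  have h3 : ‖∏ j, e j (pSum n j)‖ ≤ D ^ r := by
    rw [norm_prod]
    refine (Finset.prod_le_prod (fun _ _ => norm_nonneg _) fun j _ => he j _).trans ?_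
    simp
  have h4 : ‖∏ i, rising (s i) (n i)‖ ≤ ∏ i, rising (R i) (n i) := by
    rw [norm_prod]
    exact Finset.prod_le_prod (fun _ _ => norm_nonneg _) fun i _ => norm_rising_le (hs i) _
  have h5 : 0 ≤ ∏ i, rising (R i) (n i) := (norm_nonneg _).trans h4
  have h6 : 0 < 1 - q := sub_pos.2 hq1
  rw [expansionTerm, norm_mul, norm_mul, norm_mul, h1, h2, Finset.prod_mul_distrib]
  calc _ ≤ (1 - q) ^ (∑ i, s i).re * (∏ i, rising (R i) (n i)) *
        (q ^ (∑ i, s i).re * (∏ i, q ^ n i) * D ^ r) := by gcongr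
    _ = _ := by ring

theorem hasSum_prod_rising (hq0 : 0 < q) (hq1 : q < 1) {r : ℕ} (R : Fin r → ℝ) :
    HasSum (fun n : Fin r → ℕ => ∏ i, rising (R i) (n i) * q ^ n i) (∏ i, ((1 - q) ^ R i)⁻¹) := by
  have h i := hasSum_real_rising_mul_pow (R i) hq0.le hq1
  simpa only [(h _).tsum_eq] using
    (hasSum_pi_prod (f := fun i m => rising (R i) m * q ^ m) fun i => (h i).summable.norm).2

theorem summable_norm_expansionTerm (hq0 : 0 < q) (hq1 : q < 1) {r : ℕ} {s : Fin r → ℂ}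
    {R : Fin r → ℝ} {e : Fin r → ℕ → ℂ} {D : ℝ} (hs : ∀ i, ‖s i‖ ≤ R i)
    (he : ∀ j N, ‖e j N‖ ≤ D) :
    (Summable fun n => ‖expansionTerm q s e n‖) ∧ ∑' n, ‖expansionTerm q s e n‖ ≤
      (1 - q) ^ (∑ i, s i).re * q ^ (∑ i, s i).re * D ^ r * ∏ i, ((1 - q) ^ R i)⁻¹ := by
  have h := (hasSum_prod_rising hq0 hq1 R).mul_left
    ((1 - q) ^ (∑ i, s i).re * q ^ (∑ i, s i).re * D ^ r)
  have h1 := Summable.of_nonneg_of_le (fun n => norm_nonneg (expansionTerm q s e n))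
    (norm_expansionTerm_le hq0 hq1 hs he) h.summable
  exact ⟨h1, (h1.tsum_le_tsum (norm_expansionTerm_le hq0 hq1 hs he) h.summable).trans_eq h.tsum_eq⟩

theorem norm_inv_one_sub_cpow_le (hq0 : 0 < q) (hq1 : q < 1) {δ : ℝ} (hδ : 0 < δ) {w : ℂ}
    (hw : δ ≤ w.re) : ‖(1 - (q : ℂ) ^ w)⁻¹‖ ≤ (1 - q ^ δ)⁻¹ := by
  have h1 : q ^ w.re ≤ q ^ δ := Real.rpow_le_rpow_of_exponent_ge hq0 hq1.le hw
  have h2 : q ^ δ < 1 := Real.rpow_lt_one hq0.le hq1 hδ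
  rw [norm_inv]
  refine inv_anti₀ (sub_pos.2 h2) ?_
  have h3 := norm_sub_norm_le (1 : ℂ) ((q : ℂ) ^ w)
  rw [Complex.norm_cpow_eq_rpow_re_of_pos hq0, norm_one] at h3
  linarith

theorem one_sub_cpow_ne_zero (hq0 : 0 < q) (hq1 : q < 1) {w : ℂ} (hw : 0 < w.re) :
    1 - (q : ℂ) ^ w ≠ 0 := by
  intro h
  have h1 := congrArg norm (sub_eq_zero.1 h)
  rw [Complex.norm_cpow_eq_rpow_re_of_pos hq0, norm_one] at h1
  exact (Real.rpow_lt_one hq0.le hq1 hw).ne' h1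

theorem cpow_add_natCast (hq0 : 0 < q) (w : ℂ) (N : ℕ) :
    (q : ℂ) ^ (w + N) = (q : ℂ) ^ w * (q : ℂ) ^ N := by
  rw [Complex.cpow_add _ _ (by exact_mod_cast hq0.ne'), Complex.cpow_natCast]

/-- For fixed s the coefficients tend to 1 as N grows. A vanishing denominator contributes the value
0, so poles need not be excluded. -/
theorem exists_norm_geomCoeff_le (hq0 : 0 < q) (hq1 : q < 1) {r : ℕ} (s : Fin r → ℂ) :
    ∃ D, 0 ≤ D ∧ ∀ j N, ‖geomCoeff q s j N‖ ≤ D := by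
  have h (j : Fin r) : ∃ D, ∀ N, ‖geomCoeff q s j N‖ ≤ D := by
    have h1 : Tendsto (fun N : ℕ => geomCoeff q s j N) atTop (𝓝 1) := by
      have h2 : Tendsto (fun N : ℕ => (q : ℂ) ^ N) atTop (𝓝 0) := by
        refine tendsto_pow_atTop_nhds_zero_of_norm_lt_one ?_
        simpa [abs_of_pos hq0] using hq1
      have h3 := ((h2.const_mul ((q : ℂ) ^ pSum s j)).const_sub 1).inv₀ (by simp)
      simpa only [geomCoeff, cpow_add_natCast hq0, mul_zero, sub_zero, inv_one] using h3
    obtain ⟨D, hD⟩ := (Metric.isBounded_range_of_tendsto _ h1).exists_norm_le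
    exact ⟨D, fun N => hD _ ⟨N, rfl⟩⟩
  choose D hD using h
  refine ⟨∑ j, |D j|, Finset.sum_nonneg fun j _ => abs_nonneg _, fun j N => ?_⟩
  exact ((hD j N).trans (le_abs_self _)).trans
    (Finset.single_le_sum (f := fun j => |D j|) (fun j _ => abs_nonneg _) (Finset.mem_univ j))

theorem summable_norm_expansionTerm_geomCoeff (hq0 : 0 < q) (hq1 : q < 1) {r : ℕ}
    (s : Fin r → ℂ) : Summable fun n => ‖expansionTerm q s (geomCoeff q s) n‖ := by
  obtain ⟨D, -, hD⟩ := exists_norm_geomCoeff_le hq0 hq1 s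
  exact (summable_norm_expansionTerm hq0 hq1 (fun i => le_rfl) hD).1

/-- The product of the first `M` denominators `1 - q ^ (w + N)`. -/
noncomputable def denom (q : ℝ) (M : ℕ) (w : ℂ) : ℂ :=
  ∏ N ∈ Finset.range M, (1 - (q : ℂ) ^ (w + N))

/-- The quotient of `denom q M w` by `1 - q ^ (w + N)`, simplified if `N < M`. -/
noncomputable def denomQuot (q : ℝ) (M : ℕ) (w : ℂ) (N : ℕ) : ℂ :=
  if N < M then ∏ k ∈ (Finset.range M).erase N, (1 - (q : ℂ) ^ (w + k))
  else denom q M w * (1 - (q : ℂ) ^ (w + N))⁻¹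

theorem denomQuot_eq {M : ℕ} {w : ℂ} (h : denom q M w ≠ 0) (N : ℕ) :
    denomQuot q M w N = denom q M w * (1 - (q : ℂ) ^ (w + N))⁻¹ := by
  rw [denomQuot]
  split_ifs with hN
  · have hN' := Finset.mem_range.2 hN
    have h1 : (1 - (q : ℂ) ^ (w + N)) ≠ 0 := Finset.prod_ne_zero_iff.1 h N hN'
    rw [denom, ← Finset.mul_prod_erase _ _ hN', mul_comm, inv_mul_cancel_left₀ h1]
  · rfl

/-- For N < M only a product of fewer than M bounded factors remains; for N ≥ M the remaining
denominator has an exponent of real part at least δ, which keeps it away from 0. The bound depends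
on neither N nor w. -/
theorem norm_denomQuot_le (hq0 : 0 < q) (hq1 : q < 1) {M : ℕ} {w : ℂ} {δ R : ℝ} (hδ : 0 < δ)
    (hM : δ ≤ w.re + M) (hR : -R ≤ w.re) (N : ℕ) :
    ‖denomQuot q M w N‖ ≤ (1 + q ^ (-R)) ^ M * (1 - q ^ δ)⁻¹ := by
  have hB (k : ℕ) : ‖1 - (q : ℂ) ^ (w + k)‖ ≤ 1 + q ^ (-R) := by
    refine (norm_sub_le _ _).trans ?_
    rw [norm_one, Complex.norm_cpow_eq_rpow_re_of_pos hq0]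
    gcongr 1 + ?_
    refine Real.rpow_le_rpow_of_exponent_ge hq0 hq1.le ?_
    have : (0 : ℝ) ≤ k := k.cast_nonneg
    simp only [Complex.add_re, Complex.natCast_re]
    linarith
  have hB1 : 1 ≤ 1 + q ^ (-R) := le_add_of_nonneg_right (by positivity)
  have hprod (t : Finset ℕ) (ht : t.card ≤ M) :
      ‖∏ k ∈ t, (1 - (q : ℂ) ^ (w + k))‖ ≤ (1 + q ^ (-R)) ^ M := by
    rw [norm_prod]
    refine (Finset.prod_le_prod (fun _ _ => norm_nonneg _) fun k _ => hB k).trans ?_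
    rw [Finset.prod_const]
    exact pow_le_pow_right₀ hB1 ht
  have hδ1 : 0 < 1 - q ^ δ := sub_pos.2 (Real.rpow_lt_one hq0.le hq1 hδ)
  rw [denomQuot]
  split_ifs with hN
  · refine (hprod _ ((Finset.card_erase_le).trans (by simp))).trans ?_
    refine le_mul_of_one_le_right (by positivity) ((one_le_inv₀ hδ1).2 ?_)
    linarith [Real.rpow_nonneg hq0.le δ]
  · rw [norm_mul]
    refine mul_le_mul (hprod _ (by simp)) (norm_inv_one_sub_cpow_le hq0 hq1 hδ ?_)
      (norm_nonneg _) (by positivity)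
    have : (M : ℝ) ≤ N := by exact_mod_cast not_lt.1 hN
    simp only [Complex.add_re, Complex.natCast_re]
    linarith

theorem differentiable_one_sub_cpow (hq0 : 0 < q) (a : ℂ) :
    Differentiable ℂ fun w : ℂ => 1 - (q : ℂ) ^ (w + a) := by
  have : (q : ℂ) ≠ 0 := by exact_mod_cast hq0.ne'
  intro w
  exact (differentiableAt_const _).sub
    (((differentiableAt_id.add_const a)).const_cpow (Or.inl this))

theorem differentiable_denom (hq0 : 0 < q) (M : ℕ) : Differentiable ℂ (denom q M) := by
  unfold denom
  exact Differentiable.fun_finsetProd fun N _ => differentiable_one_sub_cpow hq0 _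

theorem differentiableAt_denomQuot (hq0 : 0 < q) (hq1 : q < 1) {M : ℕ} {w : ℂ}
    (hM : 0 < w.re + M) (N : ℕ) : DifferentiableAt ℂ (fun w => denomQuot q M w N) w := by
  unfold denomQuot
  split_ifs with hN
  · exact Differentiable.fun_finsetProd (fun k _ => differentiable_one_sub_cpow hq0 _) w
  · refine (differentiable_denom hq0 M w).mul ((differentiable_one_sub_cpow hq0 N w).fun_inv ?_)
    refine one_sub_cpow_ne_zero hq0 hq1 ?_
    have : (M : ℝ) ≤ N := by exact_mod_cast not_lt.1 hN
    simp only [Complex.add_re, Complex.natCast_re]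
    linarith

theorem analyticAt_tsum_expansionTerm_denomQuot (hq0 : 0 < q) (hq1 : q < 1) {r : ℕ} {M : ℕ}
    {z : Fin r → ℂ} (hz : ∀ j, 0 < (pSum z j).re + M) :
    AnalyticAt ℂ (fun s => ∑' n, expansionTerm q s (fun j N => denomQuot q M (pSum s j) N) n) z := by
  obtain ⟨δ, hδ, hδ0⟩ : ∃ δ, (∀ j, δ < (pSum z j).re + M) ∧ 0 < δ :=
    ((eventually_all.2 fun j => mem_of_superset (Ioo_mem_nhdsGT (hz j)) fun _ h => h.2).and
      (self_mem_nhdsWithin (s := Set.Ioi (0 : ℝ)))).exists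
  have hnear : ∀ᶠ s in 𝓝 z, (∀ j, δ < (pSum s j).re + M) ∧ ‖s‖ < ‖z‖ + 1 := by
    refine (eventually_all.2 fun j => ?_).and ?_
    · have h1 : Continuous fun s : Fin r → ℂ => (pSum s j).re + M :=
        (Complex.continuous_re.comp (differentiable_pSum j).continuous).add continuous_const
      exact (h1.tendsto z).eventually (lt_mem_nhds (hδ j))
    · exact (continuous_norm.tendsto z).eventually (gt_mem_nhds (lt_add_one _))
  obtain ⟨ρ, hρ, hball⟩ := Metric.eventually_nhds_iff_ball.1 hnear
  set R := ‖z‖ + 1 with hR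
  have hR0 : 0 ≤ R := by positivity
  have hcoord : ∀ s ∈ Metric.ball z ρ, ∀ i, ‖s i‖ ≤ R := fun s hs i =>
    (norm_le_pi_norm s i).trans (hball s hs).2.le
  have hsum : ∀ s ∈ Metric.ball z ρ, ∀ t : Finset (Fin r), -(r * R) ≤ (∑ i ∈ t, s i).re := by
    intro s hs t
    have h1 : ‖∑ i ∈ t, s i‖ ≤ r * R := by
      refine (norm_sum_le_of_le _ fun i _ => hcoord s hs i).trans ?_
      rw [Finset.sum_const, nsmul_eq_mul]
      gcongr
      exact_mod_cast (Finset.card_le_univ t).trans (by simp)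
    linarith [neg_le_of_abs_le ((Complex.abs_re_le_norm (∑ i ∈ t, s i)).trans h1)]
  refine analyticAt_tsum_of_summable_norm hρ
    ((hasSum_prod_rising hq0 hq1 fun _ => R).mul_left ((1 - q) ^ (-(r * R)) * q ^ (-(r * R)) *
      ((1 + q ^ (-(r * R))) ^ M * (1 - q ^ δ)⁻¹) ^ r)).summable ?_ ?_
  · intro n s hs
    refine DifferentiableAt.differentiableWithinAt ?_
    have hq : (q : ℂ) ≠ 0 := by exact_mod_cast hq0.ne'
    have hq' : ((1 - q : ℝ) : ℂ) ≠ 0 := by exact_mod_cast (sub_pos.2 hq1).ne'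
    unfold expansionTerm
    refine (DifferentiableAt.fun_mul ?_ ?_).fun_mul (DifferentiableAt.fun_mul ?_ ?_)
    · exact DifferentiableAt.const_cpow (by fun_prop) (Or.inl hq')
    · refine (HasFDerivAt.finsetProd fun i _ => DifferentiableAt.hasFDerivAt
        (f := fun s : Fin r → ℂ => rising (s i) (n i)) ?_).differentiableAt
      exact (differentiable_rising (n i) _).comp s (differentiableAt_apply i s)
    · exact DifferentiableAt.const_cpow (by fun_prop) (Or.inl hq)
    · simp only
      refine (HasFDerivAt.finsetProd fun j _ => DifferentiableAt.hasFDerivAt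
        (f := fun s : Fin r → ℂ => denomQuot q M (pSum s j) (pSum n j)) ?_).differentiableAt
      exact (differentiableAt_denomQuot hq0 hq1 (hδ0.trans ((hball s hs).1 j)) _).comp s
        (differentiable_pSum j s)
  · intro n s hs
    refine (norm_expansionTerm_le hq0 hq1 (hcoord s hs) (fun j N =>
      norm_denomQuot_le hq0 hq1 hδ0 ((hball s hs).1 j).le (hsum s hs _) N) n).trans ?_
    have h1 : 0 < 1 - q := sub_pos.2 hq1
    have h2 : 0 < 1 - q ^ δ := sub_pos.2 (Real.rpow_lt_one hq0.le hq1 hδ0)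
    have h3 : 0 ≤ ∏ i, rising R (n i) * q ^ n i :=
      Finset.prod_nonneg fun i _ => mul_nonneg (rising_nonneg hR0 _) (by positivity)
    gcongr ?_ * ?_ * _ * _
    · exact Real.rpow_le_rpow_of_exponent_ge h1 (by linarith) (hsum s hs _)
    · exact Real.rpow_le_rpow_of_exponent_ge hq0 hq1.le (hsum s hs _)

theorem tsum_expansionTerm_denomQuot {r : ℕ} {M : ℕ} {s : Fin r → ℂ}
    (h : ∏ j, denom q M (pSum s j) ≠ 0) :
    ∑' n, expansionTerm q s (fun j N => denomQuot q M (pSum s j) N) n =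
      (∏ j, denom q M (pSum s j)) * extension q s := by
  rw [extension, ← tsum_mul_left]
  refine tsum_congr fun n => ?_
  have h1 (j : Fin r) := denomQuot_eq (Finset.prod_ne_zero_iff.1 h j (Finset.mem_univ j))
    (pSum n j)
  simp only [expansionTerm, h1, Finset.prod_mul_distrib, geomCoeff]
  ring

theorem analyticAt_extension (hq0 : 0 < q) (hq1 : q < 1) {r : ℕ} {z : Fin r → ℂ}
    (hz : ∀ j, 0 < (pSum z j).re) : AnalyticAt ℂ (extension q) z := by
  have := analyticAt_tsum_expansionTerm_denomQuot hq0 hq1 (M := 0) (by simpa using hz)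
  simpa [tsum_expansionTerm_denomQuot, denom] using this

theorem not_eventually_prod_denom_eq_zero (hq0 : 0 < q) (hq1 : q < 1) {r : ℕ} (hr : 1 ≤ r)
    (M : ℕ) (z : Fin r → ℂ) : ¬ ∀ᶠ s in 𝓝 z, ∏ j, denom q M (pSum s j) = 0 := by
  obtain ⟨r, rfl⟩ : ∃ m, r = m + 1 := ⟨r - 1, by omega⟩
  intro h
  -- Moving the first coordinate by a real t adds t to every partial sum. A zero of the product
  -- forces some partial sum to have real part -N with N < M, which excludes only finitely many t.
  let γ : ℝ → Fin (r + 1) → ℂ := fun t => Function.update z 0 (z 0 + t)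
  have hγ : Tendsto γ (𝓝[≠] 0) (𝓝 z) := by
    have h1 : Continuous γ := continuous_const.update 0 (by fun_prop)
    have h2 := h1.tendsto 0
    simp only [γ, Complex.ofReal_zero, add_zero, Function.update_eq_self] at h2
    exact h2.mono_left nhdsWithin_le_nhds
  have hsum (t : ℝ) (j : Fin (r + 1)) : pSum (γ t) j = pSum z j + t := by
    have h0 : (0 : Fin (r + 1)) ∈ Finset.Iic j := by simp
    rw [pSum, pSum, ← Finset.add_sum_erase _ _ h0, ← Finset.add_sum_erase _ _ h0]
    have : ∀ i ∈ (Finset.Iic j).erase 0, γ t i = z i := fun i hi =>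
      Function.update_of_ne (Finset.ne_of_mem_erase hi) _ _
    rw [Finset.sum_congr rfl this]
    simp only [γ, Function.update_self]
    ring
  have havoid : ∀ᶠ t in 𝓝[≠] (0 : ℝ), ∀ j : Fin (r + 1), ∀ N : Fin M,
      t ≠ -((pSum z j).re + N) := by
    refine eventually_all.2 fun j => eventually_all.2 fun N => ?_
    exact nhdsNE_le_cofinite 0 (Set.finite_singleton _).compl_mem_cofinite
  obtain ⟨t, ht1, ht2⟩ := (havoid.and (hγ.eventually h)).exists
  obtain ⟨j, -, hj⟩ := Finset.prod_eq_zero_iff.1 ht2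
  obtain ⟨N, hN, hN'⟩ := Finset.prod_eq_zero_iff.1 hj
  refine ht1 j ⟨N, Finset.mem_range.1 hN⟩ ?_
  have h1 := congrArg norm (sub_eq_zero.1 hN')
  rw [Complex.norm_cpow_eq_rpow_re_of_pos hq0, norm_one, hsum] at h1
  have h2 := congrArg Real.log h1
  rw [Real.log_one, Real.log_rpow hq0, zero_eq_mul,
    or_iff_left (Real.log_neg hq0 hq1).ne] at h2
  simp only [Complex.add_re, Complex.natCast_re, Complex.ofReal_re] at h2
  simp only
  linarith

theorem exists_nat_pos_re_add {ι : Type*} [Fintype ι] (w : ι → ℂ) :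
    ∃ M : ℕ, ∀ j, 0 < (w j).re + M := by
  obtain ⟨M, hM⟩ := exists_nat_gt (∑ j, |(w j).re|)
  refine ⟨M, fun j => ?_⟩
  have h1 := Finset.single_le_sum (f := fun j => |(w j).re|) (fun j _ => abs_nonneg _)
    (Finset.mem_univ j)
  linarith [neg_abs_le (w j).re]

theorem isMeromorphic_extension (hq0 : 0 < q) (hq1 : q < 1) {r : ℕ} (hr : 1 ≤ r) :
    IsMeromorphic (extension q : (Fin r → ℂ) → ℂ) := by
  intro z
  obtain ⟨M, hM⟩ := exists_nat_pos_re_add fun j => pSum z j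
  refine ⟨_, fun s => ∏ j, denom q M (pSum s j),
    analyticAt_tsum_expansionTerm_denomQuot hq0 hq1 hM, ?_,
    not_eventually_prod_denom_eq_zero hq0 hq1 hr M z, Eventually.of_forall fun s hs => ?_⟩
  · refine Finset.analyticAt_fun_prod _ fun j _ => ?_
    have h1 : AnalyticAt ℂ (fun s : Fin r → ℂ => pSum s j) z :=
      Finset.analyticAt_fun_sum _ fun i _ =>
        (ContinuousLinearMap.proj (R := ℂ) (φ := fun _ : Fin r => ℂ) i).analyticAt z
    exact ((differentiable_denom hq0 M).analyticAt _).fun_comp h1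
  · rw [tsum_expansionTerm_denomQuot hs, mul_div_cancel_left₀ _ hs]

end Continuation

/-! ### The continuation agrees with the defining series. -/

section Convergence

/-- The tuple `k` with `k_r = 1 + m_r` and `k_i = k_{i+1} + m_i`. -/
def starTuple {r : ℕ} (m : Fin r → ℕ) (i : Fin r) : ℕ := 1 + ∑ j ∈ Finset.Ici i, m j

/-- The successor entry `k_{i+1}` of a tuple, with `k_{r+1} = 1`. -/
def nextEntry {r : ℕ} (k : Fin r → ℕ) (i : Fin r) : ℕ :=
  if h : i.1 + 1 < r then k ⟨i.1 + 1, h⟩ else 1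

theorem starTuple_eq {r : ℕ} (m : Fin r → ℕ) (i : Fin r) :
    starTuple m i = m i + nextEntry (starTuple m) i := by
  have h1 : Finset.Ici i = insert i (Finset.Ioi i) := (Finset.Ioi_insert i).symm
  rw [starTuple, h1, Finset.sum_insert (by simp), nextEntry]
  split_ifs with h
  · have h2 : Finset.Ioi i = Finset.Ici ⟨i.1 + 1, h⟩ := by
      ext j
      rw [Finset.mem_Ioi, Finset.mem_Ici, Fin.lt_def, Fin.le_def, Nat.lt_iff_add_one_le]
    rw [h2, starTuple]
    ring
  · have h2 : Finset.Ioi i = ∅ := Finset.eq_empty_of_forall_notMem fun j hj =>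
      h (lt_of_le_of_lt (Fin.lt_def.1 (Finset.mem_Ioi.1 hj)) j.2)
    rw [h2, Finset.sum_empty]
    ring

theorem antitone_starTuple {r : ℕ} (m : Fin r → ℕ) : Antitone (starTuple m) := by
  intro i j hij
  exact Nat.add_le_add_left (Finset.sum_le_sum_of_subset (Finset.Ici_subset_Ici.2 hij)) 1

/-- The parametrization of the tuples `k₁ ≥ ⋯ ≥ k_r ≥ 1` by the differences of their entries. -/
noncomputable def starEquiv (r : ℕ) : (Fin r → ℕ) ≃ StarIndex r :=
  Equiv.ofBijective
    (fun m => ⟨starTuple m, antitone_starTuple m, fun _ => Nat.le_add_right _ _⟩) <| by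
    constructor
    · intro m m' h
      have h1 : starTuple m = starTuple m' := congrArg Subtype.val h
      funext i
      have h2 := starTuple_eq m i
      rw [h1, starTuple_eq m' i] at h2
      omega
    · rintro ⟨k, hk, hk1⟩
      refine ⟨fun i => k i - nextEntry k i, Subtype.ext (funext fun i => ?_)⟩
      -- Entries are recovered from the last one backwards, since each is its difference plus the
      -- next entry.
      induction i using WellFoundedGT.induction with
      | ind i ih =>
        simp only at ih ⊢
        have h0 : nextEntry k i ≤ k i := by
          unfold nextEntry
          split_ifs with h
          · exact hk (Fin.le_def.2 (Nat.le_succ _))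
          · exact hk1 i
        rw [starTuple_eq]
        have h1 : nextEntry (starTuple fun i => k i - nextEntry k i) i = nextEntry k i := by
          rw [nextEntry, nextEntry]
          split_ifs with h
          · exact ih _ (Fin.lt_def.2 (Nat.lt_succ_self _))
          · rfl
        rw [h1]
        omega

theorem starEquiv_val {r : ℕ} (m : Fin r → ℕ) : (starEquiv r m).1 = starTuple m := rfl

/-- Abel summation: the difference `m j` occurs in exactly the entries with index at most j. This is
where the partial sums defining `U` come from. -/
theorem sum_starTuple_mul {r : ℕ} (m : Fin r → ℕ) (t : Fin r → ℂ) :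
    ∑ i, (starTuple m i : ℂ) * t i = ∑ i, t i + ∑ j, (m j : ℂ) * pSum t j := by
  have h : ∑ i, ∑ j ∈ Finset.Ici i, (m j : ℂ) * t i = ∑ j, ∑ i ∈ Finset.Iic j, (m j : ℂ) * t i :=
    Finset.sum_comm' (by simp)
  simp only [starTuple, pSum, Finset.mul_sum, ← h, ← Finset.sum_add_distrib]
  refine Finset.sum_congr rfl fun i _ => ?_
  push_cast
  rw [add_mul, one_mul, Finset.sum_mul]

variable {q : ℝ}

theorem cpow_sum {ι : Type*} {x : ℂ} (hx : x ≠ 0) (t : Finset ι) (f : ι → ℂ) :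
    x ^ (∑ i ∈ t, f i) = ∏ i ∈ t, x ^ f i := by
  simp only [Complex.cpow_def_of_ne_zero hx, Finset.mul_sum, Complex.exp_sum]

theorem ofReal_qNat_cpow (hq0 : 0 < q) (hq1 : q < 1) (k : ℕ) (s : ℂ) :
    ((qNat q k : ℝ) : ℂ) ^ s =
      ((1 - q ^ k : ℝ) : ℂ) ^ s * (((1 - q : ℝ) : ℂ) ^ s)⁻¹ := by
  have h1 : 0 < 1 - q := sub_pos.2 hq1
  have h2 : 0 ≤ 1 - q ^ k := sub_nonneg.2 (pow_le_one₀ hq0.le hq1.le)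
  rw [qNat, div_eq_mul_inv, Complex.ofReal_mul, Complex.mul_cpow_ofReal_nonneg h2 (by positivity),
    Complex.ofReal_inv, Complex.inv_cpow]
  rw [Complex.arg_ofReal_of_nonneg h1.le]
  exact Real.pi_ne_zero.symm

theorem starTerm_eq (hq0 : 0 < q) (hq1 : q < 1) {r : ℕ} (s : Fin r → ℂ) (k : Fin r → ℕ) :
    starTerm q s k = ((1 - q : ℝ) : ℂ) ^ (∑ i, s i) * (q : ℂ) ^ (∑ i, (k i : ℂ) * s i) *
      ∏ i, (((1 - q ^ k i : ℝ) : ℂ) ^ s i)⁻¹ := by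
  have h1 : ((1 - q : ℝ) : ℂ) ≠ 0 := by exact_mod_cast (sub_pos.2 hq1).ne'
  rw [starTerm, cpow_sum h1, div_eq_mul_inv, ← Finset.prod_inv_distrib]
  simp only [ofReal_qNat_cpow hq0 hq1, mul_inv, inv_inv, Finset.prod_mul_distrib]
  ring

/-- The summand of the double series over the tuples `k` and the exponents `n`. -/
noncomputable def doubleTerm (q : ℝ) {r : ℕ} (s : Fin r → ℂ) (m n : Fin r → ℕ) : ℂ :=
  ((1 - q : ℝ) : ℂ) ^ (∑ i, s i) * (∏ i, rising (s i) (n i)) *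
    (q : ℂ) ^ (∑ i, (starTuple m i : ℂ) * (s i + n i))

theorem hasSum_doubleTerm_right (hq0 : 0 < q) (hq1 : q < 1) {r : ℕ} (s : Fin r → ℂ)
    (m : Fin r → ℕ) : HasSum (doubleTerm q s m) (starTerm q s (starTuple m)) := by
  have hq : (q : ℂ) ≠ 0 := by exact_mod_cast hq0.ne'
  have h i := hasSum_rising_mul_pow (s i) (x := q ^ starTuple m i) (by positivity)
    (pow_lt_one₀ hq0.le hq1 (by simp [starTuple]))
  have h1 := (hasSum_pi_prod (f := fun i n => rising (s i) n * ((q ^ starTuple m i : ℝ) : ℂ) ^ n)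
    fun i => (h i).summable.norm).2
  simp only [(h _).tsum_eq] at h1
  rw [starTerm_eq hq0 hq1]
  refine (h1.mul_left _).congr_fun fun n => ?_
  simp only [doubleTerm, mul_add, Finset.sum_add_distrib, Complex.cpow_add _ _ hq, cpow_sum hq,
    Finset.prod_mul_distrib]
  have h2 (i : Fin r) : (q : ℂ) ^ ((starTuple m i : ℂ) * (n i : ℂ)) =
      ((q ^ starTuple m i : ℝ) : ℂ) ^ n i := by
    rw [← Nat.cast_mul, Complex.cpow_natCast, pow_mul]
    push_cast
    rfl
  simp only [h2]
  ring

theorem cpow_starTuple (hq0 : 0 < q) {r : ℕ} (s : Fin r → ℂ) (m n : Fin r → ℕ) :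
    (q : ℂ) ^ (∑ i, (starTuple m i : ℂ) * (s i + n i)) =
      (q : ℂ) ^ (∑ i, (s i + n i)) * ∏ j, ((q : ℂ) ^ (pSum s j + pSum n j)) ^ m j := by
  have hq : (q : ℂ) ≠ 0 := by exact_mod_cast hq0.ne'
  rw [sum_starTuple_mul m fun i => s i + n i, Complex.cpow_add _ _ hq,
    cpow_sum hq Finset.univ fun j => (m j : ℂ) * pSum (fun i => s i + n i) j]
  simp only [pSum_add_natCast, Complex.cpow_nat_mul]

theorem norm_cpow_lt_one (hq0 : 0 < q) (hq1 : q < 1) {w : ℂ} (hw : 0 < w.re) :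
    ‖(q : ℂ) ^ w‖ < 1 := by
  rw [Complex.norm_cpow_eq_rpow_re_of_pos hq0]
  exact Real.rpow_lt_one hq0.le hq1 hw

theorem hasSum_doubleTerm_left (hq0 : 0 < q) (hq1 : q < 1) {r : ℕ} {s : Fin r → ℂ}
    (hs : ∀ j, 0 < (pSum s j).re) (n : Fin r → ℕ) :
    HasSum (fun m => doubleTerm q s m n) (expansionTerm q s (geomCoeff q s) n) := by
  have h (j : Fin r) : ‖(q : ℂ) ^ (pSum s j + pSum n j)‖ < 1 := by
    refine norm_cpow_lt_one hq0 hq1 ?_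
    simp only [Complex.add_re, Complex.natCast_re]
    exact add_pos_of_pos_of_nonneg (hs j) (Nat.cast_nonneg _)
  have h1 := (hasSum_pi_prod (f := fun j m => ((q : ℂ) ^ (pSum s j + pSum n j)) ^ m)
    fun j => (summable_geometric_of_norm_lt_one (h j)).norm).2
  simp only [tsum_geometric_of_norm_lt_one (h _)] at h1
  have h2 := h1.mul_left (((1 - q : ℝ) : ℂ) ^ (∑ i, s i) * (∏ i, rising (s i) (n i)) *
    (q : ℂ) ^ (∑ i, (s i + n i)))
  rw [mul_assoc _ ((q : ℂ) ^ _)] at h2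
  refine h2.congr_fun fun m => ?_
  rw [doubleTerm, cpow_starTuple hq0, ← mul_assoc]

/-- The ratio q^{s_1+…+s_j+n_1+…+n_j} of each geometric series is at most q^{Re(s_1+…+s_j)} < 1 in
norm, whatever n is. The double series is thus dominated by a product of a series in m and a series
in n. -/
theorem summable_doubleTerm (hq0 : 0 < q) (hq1 : q < 1) {r : ℕ} {s : Fin r → ℂ}
    (hs : ∀ j, 0 < (pSum s j).re) :
    Summable fun p : (Fin r → ℕ) × (Fin r → ℕ) => doubleTerm q s p.1 p.2 := by
  let x : Fin r → ℝ := fun j => q ^ (pSum s j).re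
  have hx0 j : 0 ≤ x j := by positivity
  have hx : Summable fun m : Fin r → ℕ => ∏ j, x j ^ m j :=
    summable_pi_prod (f := fun j m => x j ^ m) fun j =>
      summable_geometric_of_lt_one (hx0 j) (Real.rpow_lt_one hq0.le hq1 (hs j))
  have h1 := (hasSum_prod_rising hq0 hq1 fun i => ‖s i‖).summable
  have h2 := (hx.mul_of_nonneg h1 (fun m => Finset.prod_nonneg fun j _ => by positivity)
    fun n => Finset.prod_nonneg fun i _ =>
      mul_nonneg (rising_nonneg (norm_nonneg _) _) (by positivity)).mul_left
    ((1 - q) ^ (∑ i, s i).re * q ^ (∑ i, s i).re * 1 ^ r)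
  refine Summable.of_norm_bounded h2 ?_
  rintro ⟨m, n⟩
  have h3 : doubleTerm q s m n = expansionTerm q s (fun _ _ => 1) n *
      ∏ j, ((q : ℂ) ^ (pSum s j + pSum n j)) ^ m j := by
    rw [doubleTerm, cpow_starTuple hq0, expansionTerm, Finset.prod_const_one, mul_one, ← mul_assoc]
  have h4 : ‖∏ j, ((q : ℂ) ^ (pSum s j + pSum n j)) ^ m j‖ ≤ ∏ j, x j ^ m j := by
    rw [norm_prod]
    refine Finset.prod_le_prod (fun _ _ => norm_nonneg _) fun j _ => ?_
    rw [norm_pow, Complex.norm_cpow_eq_rpow_re_of_pos hq0]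
    gcongr
    exact Real.rpow_le_rpow_of_exponent_ge hq0 hq1.le (by simp)
  have h5 := norm_expansionTerm_le hq0 hq1 (s := s) (fun i => le_rfl)
    (e := fun _ _ => 1) (D := 1) (by simp) n
  rw [h3, norm_mul]
  refine (mul_le_mul h5 h4 (norm_nonneg _) ((norm_nonneg _).trans h5)).trans_eq ?_
  ring

theorem summable_starTerm (hq0 : 0 < q) (hq1 : q < 1) {r : ℕ} {s : Fin r → ℂ}
    (hs : ∀ j, 0 < (pSum s j).re) : Summable fun k : StarIndex r => starTerm q s k.1 := by
  rw [← (starEquiv r).summable_iff]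
  have h := (summable_doubleTerm hq0 hq1 hs).prod
  simp only [(hasSum_doubleTerm_right hq0 hq1 s _).tsum_eq] at h
  exact h

theorem extension_eq_zetaStar (hq0 : 0 < q) (hq1 : q < 1) {r : ℕ} {s : Fin r → ℂ}
    (hs : ∀ j, 0 < (pSum s j).re) : extension q s = zetaStar q s := by
  rw [zetaStar, ← (starEquiv r).tsum_eq, extension]
  simp only [starEquiv_val, ← (hasSum_doubleTerm_right hq0 hq1 s _).tsum_eq,
    ← (hasSum_doubleTerm_left hq0 hq1 hs _).tsum_eq]
  exact (summable_doubleTerm hq0 hq1 hs).tsum_comm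

end Convergence

/-! ### The translation formula away from the zeros of 1 - q^{s_1+a}. -/

section Translation

open Filter Topology Finset.HasAntidiagonal

theorem pSum_eq_sum_ite {A : Type*} [AddCommMonoid A] {r : ℕ} (x : Fin r → A) (j : Fin r) :
    pSum x j = ∑ i, if i ≤ j then x i else 0 := by
  rw [pSum, ← Finset.sum_filter]
  congr 1
  ext i
  simp

theorem pSum_cons_zero {A : Type*} [AddCommMonoid A] {r : ℕ} (a : A) (x : Fin r → A) :
    pSum (Fin.cons a x : Fin (r + 1) → A) 0 = a := by
  simp [pSum_eq_sum_ite]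

theorem pSum_cons_succ {A : Type*} [AddCommMonoid A] {r : ℕ} (a : A) (x : Fin r → A) (j : Fin r) :
    pSum (Fin.cons a x : Fin (r + 1) → A) j.succ = a + pSum x j := by
  simp [pSum_eq_sum_ite, Fin.sum_univ_succ]

theorem pSum_cons_add {A : Type*} [AddCommMonoid A] {r : ℕ} (a b : A) (x : Fin r → A)
    (j : Fin (r + 1)) : pSum (Fin.cons (a + b) x : Fin (r + 1) → A) j =
      a + pSum (Fin.cons b x : Fin (r + 1) → A) j := by
  refine Fin.cases ?_ (fun j => ?_) j
  · simp only [pSum_cons_zero]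
  · simp only [pSum_cons_succ, add_assoc]

theorem pSum_cons_cons_succ {A : Type*} [AddCommMonoid A] {r : ℕ} (a b : A) (x : Fin r → A)
    (j : Fin (r + 1)) :
    pSum (Fin.cons a (Fin.cons b x : Fin (r + 1) → A) : Fin (r + 2) → A) j.succ =
      pSum (Fin.cons (a + b) x : Fin (r + 1) → A) j := by
  rw [pSum_cons_succ, pSum_cons_add]

theorem shift_eq_cons {n : ℕ} (s : Fin (n + 1) → ℂ) (k : ℕ) :
    shift s k = Fin.cons ((k + 1 : ℕ) + s 0) (Fin.tail s) := by
  funext i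
  refine Fin.cases ?_ (fun i => ?_) i
  · simp [shift]
    ring
  · simp [shift, Fin.tail]

theorem pSum_shift {n : ℕ} (s : Fin (n + 1) → ℂ) (k : ℕ) (j : Fin (n + 1)) :
    pSum (shift s k) j = pSum s j + (k + 1 : ℕ) := by
  rw [shift_eq_cons, pSum_cons_add, Fin.cons_self_tail, add_comm]

theorem sum_shift {n : ℕ} (s : Fin (n + 1) → ℂ) (k : ℕ) :
    ∑ i, shift s k i = ∑ i, s i + (k + 1 : ℕ) := by
  rw [shift_eq_cons, Fin.sum_univ_succ, Fin.sum_univ_succ s]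
  simp only [Fin.cons_zero, Fin.cons_succ, Fin.tail]
  ring

theorem pSum_merge {n : ℕ} (s : Fin (n + 2) → ℂ) (j : Fin (n + 1)) :
    pSum (merge s) j = pSum s j.succ := by
  have h : s = Fin.cons (s 0) (Fin.cons (s 1) fun i => s i.succ.succ) := by
    funext i
    refine Fin.cases rfl (fun i => Fin.cases rfl (fun i => rfl) i) i
  conv_rhs => rw [h]
  rw [pSum_cons_cons_succ, merge]

variable {q : ℝ}

theorem geomCoeff_shift {n : ℕ} (s : Fin (n + 1) → ℂ) (k : ℕ) (j : Fin (n + 1)) (N : ℕ) :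
    geomCoeff q (shift s k) j N = geomCoeff q s j (k + 1 + N) := by
  rw [geomCoeff, geomCoeff, pSum_shift, add_assoc, ← Nat.cast_add]

theorem sum_natCast_cons {n : ℕ} (b : ℕ) (p : Fin n → ℕ) :
    ∑ i, ((Fin.cons b p : Fin (n + 1) → ℕ) i : ℂ) = b + ∑ i, (p i : ℂ) := by
  rw [Fin.sum_univ_succ]
  simp only [Fin.cons_zero, Fin.cons_succ]

/-- The geometric coefficients and the power of q see s_1 and the first exponent only through their
sum, so a shift moves from one to the other; the rising factorials combine with a binomial
coefficient. -/
theorem coeff_mul_expansionTerm_shift (hq1 : q < 1) {n : ℕ} (s : Fin (n + 1) → ℂ)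
    (k b : ℕ) (p : Fin n → ℕ) :
    coeff (s 0) k * expansionTerm q (shift s k) (geomCoeff q (shift s k)) (Fin.cons b p) =
      (-1) ^ k * ((1 - q : ℝ) : ℂ) ^ (k + 1) * ((k + 1 + b).choose (k + 1) : ℂ) *
        expansionTerm q s (geomCoeff q s) (Fin.cons (k + 1 + b) p) := by
  have h1 : ((1 - q : ℝ) : ℂ) ≠ 0 := by exact_mod_cast (sub_pos.2 hq1).ne'
  have h2 : ∑ i, (shift s k i + ((Fin.cons b p : Fin (n + 1) → ℕ) i : ℂ)) =
      ∑ i, (s i + ((Fin.cons (k + 1 + b) p : Fin (n + 1) → ℕ) i : ℂ)) := by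
    rw [Finset.sum_add_distrib, Finset.sum_add_distrib, sum_shift, sum_natCast_cons,
      sum_natCast_cons]
    push_cast
    ring
  have h3 (j : Fin (n + 1)) : geomCoeff q (shift s k) j (pSum (Fin.cons b p : Fin (n + 1) → ℕ) j) =
      geomCoeff q s j (pSum (Fin.cons (k + 1 + b) p : Fin (n + 1) → ℕ) j) := by
    rw [geomCoeff_shift, pSum_cons_add]
  have h4 := rising_mul_rising_add (s 0) (k + 1) b
  simp only [expansionTerm, sum_shift, h2, h3, Complex.cpow_add _ _ h1, Complex.cpow_natCast,
    coeff_eq_rising, Fin.prod_univ_succ (fun i => rising _ _), Fin.cons_zero, Fin.cons_succ]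
  have h5 : shift s k 0 = s 0 + (k + 1 : ℕ) := by simp [shift, add_assoc]
  have h6 (i : Fin n) : shift s k i.succ = s i.succ := by simp [shift]
  simp only [h5, h6]
  linear_combination ((-1) ^ k * ((1 - q : ℝ) : ℂ) ^ (∑ i, s i) * ((1 - q : ℝ) : ℂ) ^ (k + 1) *
    (∏ i : Fin n, rising (s i.succ) (p i)) *
    ((q : ℂ) ^ (∑ i, (s i + ((Fin.cons (k + 1 + b) p : Fin (n + 1) → ℕ) i : ℂ))) *
      ∏ j, geomCoeff q s j (pSum (Fin.cons (k + 1 + b) p : Fin (n + 1) → ℕ) j))) * h4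

/-- The binomial theorem for (1 - y)^{N+1} with its constant term split off. At y = 1 - q it
produces the factor 1 - q^{N+1}. -/
theorem sum_antidiagonal_choose_succ (y : ℂ) (N : ℕ) :
    ∑ x ∈ antidiagonal N, (-1) ^ x.1 * y ^ (x.1 + 1) * ((x.1 + 1 + x.2).choose (x.1 + 1) : ℂ) =
      1 - (1 - y) ^ (N + 1) := by
  have h := (Commute.all (-y) 1).add_pow' (N + 1)
  rw [Finset.Nat.sum_antidiagonal_succ] at h
  simp only [Nat.choose_zero_right, pow_zero, one_pow, mul_one, one_smul, nsmul_eq_mul] at h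
  rw [show 1 - y = -y + 1 by ring, h, sub_add_cancel_left, ← Finset.sum_neg_distrib]
  refine Finset.sum_congr rfl fun x hx => ?_
  rw [← mem_antidiagonal.1 hx, neg_pow, show x.1 + 1 + x.2 = x.1 + x.2 + 1 by ring]
  ring

/-- Cauchy product with respect to the first entry of a tuple. -/
theorem tsum_tsum_eq_tsum_antidiagonal {n : ℕ} {F : ℕ → (Fin (n + 1) → ℕ) → ℂ}
    (hF : Summable fun x : ℕ × (Fin (n + 1) → ℕ) => F x.1 x.2) :
    ∑' k, ∑' m, F k m = ∑' m : Fin (n + 1) → ℕ,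
      ∑ x ∈ antidiagonal (m 0), F x.1 (Fin.cons x.2 (Fin.tail m)) := by
  rw [← hF.tsum_prod]
  -- The double series is regrouped along the fibres of `g`, each of which is a finite antidiagonal.
  let g : ℕ × (Fin (n + 1) → ℕ) → (Fin (n + 1) → ℕ) := fun x =>
    Fin.cons (x.1 + x.2 0) (Fin.tail x.2)
  rw [← (hF.hasSum.tsum_fiberwise g).tsum_eq]
  refine tsum_congr fun m => ?_
  let φ : ℕ × ℕ → ℕ × (Fin (n + 1) → ℕ) := fun x => (x.1, Fin.cons x.2 (Fin.tail m))
  have hφ : Function.Injective φ := by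
    intro x y h
    have h1 := congrArg Prod.fst h
    have h2 := congrFun (congrArg Prod.snd h) 0
    exact Prod.ext h1 h2
  have hset : g ⁻¹' {m} = ((antidiagonal (m 0)).map ⟨φ, hφ⟩ : Finset (ℕ × (Fin (n + 1) → ℕ))) := by
    ext ⟨k, l⟩
    simp only [Set.mem_preimage, Set.mem_singleton_iff, Finset.coe_map, Function.Embedding.coeFn_mk,
      Set.mem_image, Finset.mem_coe, mem_antidiagonal, g, φ]
    constructor
    · rintro rfl
      exact ⟨(k, l 0), rfl, by simp [Fin.tail_cons, Fin.cons_self_tail]⟩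
    · rintro ⟨x, hx, h⟩
      obtain ⟨rfl, rfl⟩ := Prod.mk.inj h
      simp [hx, Fin.tail_cons, Fin.cons_self_tail]
  rw [hset, Finset.tsum_subtype' _ fun x : ℕ × (Fin (n + 1) → ℕ) => F x.1 x.2, Finset.sum_map]
  rfl

/-- The bound for the terms of the translation formula. -/
noncomputable def shiftBound (q R D : ℝ) (r k : ℕ) : ℝ :=
  (1 - q) ^ (-(r * R)) * q ^ (-(r * R)) * D ^ r * (((1 - q) ^ R)⁻¹) ^ r *
    (rising R (k + 1) * q ^ (k + 1))

theorem summable_shiftBound (hq0 : 0 < q) (hq1 : q < 1) (R D : ℝ) (r : ℕ) :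
    Summable (shiftBound q R D r) :=
  ((summable_nat_add_iff 1).2 (hasSum_real_rising_mul_pow R hq0.le hq1).summable).mul_left _

/-- Enlarging the first radius to R + k + 1 costs (1-q)^{-(k+1)}, exactly offset by the power of 1-q
gained from the shifted prefactor. The surviving q^{k+1} makes the bound summable in k. -/
theorem summable_norm_coeff_mul_expansionTerm (hq0 : 0 < q) (hq1 : q < 1) {n : ℕ}
    {s : Fin (n + 1) → ℂ} {k : ℕ} {R D : ℝ} (hR : ∀ i, ‖s i‖ ≤ R)
    (hD : ∀ j N, ‖geomCoeff q (shift s k) j N‖ ≤ D) :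
    (Summable fun m =>
      ‖coeff (s 0) k * expansionTerm q (shift s k) (geomCoeff q (shift s k)) m‖) ∧
    ∑' m, ‖coeff (s 0) k * expansionTerm q (shift s k) (geomCoeff q (shift s k)) m‖ ≤
      shiftBound q R D (n + 1) k := by
  have hR0 : 0 ≤ R := (norm_nonneg _).trans (hR 0)
  have hD0 : 0 ≤ D := (norm_nonneg _).trans (hD 0 0)
  have hq : 0 < 1 - q := sub_pos.2 hq1
  have hR' : ∀ i, ‖shift s k i‖ ≤
      (Fin.cons ((k + 1 : ℕ) + R) fun _ => R : Fin (n + 1) → ℝ) i := by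
    intro i
    rw [shift_eq_cons]
    refine Fin.cases ?_ (fun i => ?_) i
    · simp only [Fin.cons_zero]
      refine (norm_add_le _ _).trans (add_le_add ?_ (hR 0))
      rw [RCLike.norm_natCast]
    · simpa [Fin.tail] using hR i.succ
  obtain ⟨h1, h2⟩ := summable_norm_expansionTerm hq0 hq1 hR' hD
  simp only [norm_mul, tsum_mul_left]
  refine ⟨h1.mul_left _, ?_⟩
  have h3 : ‖coeff (s 0) k‖ ≤ rising R (k + 1) := by
    rw [coeff_eq_rising, norm_mul, norm_pow, norm_neg, norm_one, one_pow, one_mul]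
    exact norm_rising_le (hR 0) _
  have h4 : -((n + 1 : ℕ) * R) ≤ (∑ i, s i).re := by
    have h5 : ‖∑ i, s i‖ ≤ (n + 1 : ℕ) * R := by
      refine (norm_sum_le_of_le _ fun i _ => hR i).trans ?_
      simp
    linarith [neg_le_of_abs_le ((Complex.abs_re_le_norm (∑ i, s i)).trans h5)]
  have h6 {x : ℝ} (hx0 : 0 < x) (hx1 : x < 1) : x ^ (∑ i, shift s k i).re ≤
      x ^ (-((n + 1 : ℕ) * R)) * x ^ (k + 1) := by
    rw [sum_shift, Complex.add_re, Complex.natCast_re, Real.rpow_add hx0, Real.rpow_natCast]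
    exact mul_le_mul_of_nonneg_right (Real.rpow_le_rpow_of_exponent_ge hx0 hx1.le h4)
      (by positivity)
  have h7 : ∏ i, ((1 - q) ^ (Fin.cons ((k + 1 : ℕ) + R) fun _ => R : Fin (n + 1) → ℝ) i)⁻¹ =
      (((1 - q) ^ R)⁻¹) ^ (n + 1) * ((1 - q) ^ (k + 1))⁻¹ := by
    simp only [Fin.prod_univ_succ, Fin.cons_zero, Fin.cons_succ, Finset.prod_const,
      Finset.card_univ, Fintype.card_fin]
    rw [Real.rpow_add hq, Real.rpow_natCast, mul_inv, pow_succ (((1 - q) ^ R)⁻¹)]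
    ring
  rw [h7] at h2
  have h8 : (1 - q) ^ (k + 1) * ((1 - q) ^ (k + 1))⁻¹ = 1 := mul_inv_cancel₀ (by positivity)
  calc _ ≤ rising R (k + 1) * ((1 - q) ^ (-((n + 1 : ℕ) * R)) * (1 - q) ^ (k + 1) *
        (q ^ (-((n + 1 : ℕ) * R)) * q ^ (k + 1)) * D ^ (n + 1) *
        ((((1 - q) ^ R)⁻¹) ^ (n + 1) * ((1 - q) ^ (k + 1))⁻¹)) := by
        refine mul_le_mul h3 (h2.trans ?_) (tsum_nonneg fun _ => norm_nonneg _)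
          (rising_nonneg hR0 _)
        gcongr
        · exact h6 hq (by linarith)
        · exact h6 hq0 hq1
    _ = _ := by
      rw [shiftBound]
      linear_combination (rising R (k + 1) * (1 - q) ^ (-((n + 1 : ℕ) * R)) *
        (q ^ (-((n + 1 : ℕ) * R)) * q ^ (k + 1)) * D ^ (n + 1) * (((1 - q) ^ R)⁻¹) ^ (n + 1)) * h8

theorem norm_coeff_mul_extension_shift_le (hq0 : 0 < q) (hq1 : q < 1) {n : ℕ}
    {s : Fin (n + 1) → ℂ} {k : ℕ} {R D : ℝ} (hR : ∀ i, ‖s i‖ ≤ R)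
    (hD : ∀ j N, ‖geomCoeff q (shift s k) j N‖ ≤ D) :
    ‖coeff (s 0) k * extension q (shift s k)‖ ≤ shiftBound q R D (n + 1) k := by
  obtain ⟨h1, h2⟩ := summable_norm_coeff_mul_expansionTerm hq0 hq1 hR hD
  rw [extension, ← tsum_mul_left]
  exact (norm_tsum_le_tsum_norm h1).trans h2

/-- After the shift by k+1 all partial sums have real part at least 1, whence the constant (1 -
q^1)⁻¹, uniform in s and k. -/
theorem norm_coeff_mul_extension_shift_le_of_re (hq0 : 0 < q) (hq1 : q < 1) {n : ℕ}
    {s : Fin (n + 1) → ℂ} {k : ℕ} {R : ℝ} (hR : ∀ i, ‖s i‖ ≤ R)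
    (hk : ∀ j, 0 ≤ (pSum s j).re + k) :
    ‖coeff (s 0) k * extension q (shift s k)‖ ≤
      shiftBound q R (1 - q ^ (1 : ℝ))⁻¹ (n + 1) k := by
  refine norm_coeff_mul_extension_shift_le hq0 hq1 hR fun j N =>
    norm_inv_one_sub_cpow_le hq0 hq1 one_pos ?_
  have h1 := hk j
  have h2 : (0 : ℝ) ≤ N := N.cast_nonneg
  rw [pSum_shift]
  simp only [Complex.add_re, Complex.natCast_re, Nat.cast_add, Nat.cast_one,
    Complex.one_re]
  linarith

theorem exists_norm_geomCoeff_shift_le (hq0 : 0 < q) (hq1 : q < 1) {n : ℕ}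
    (s : Fin (n + 1) → ℂ) : ∃ D, ∀ k j N, ‖geomCoeff q (shift s k) j N‖ ≤ D := by
  obtain ⟨D, -, hD⟩ := exists_norm_geomCoeff_le hq0 hq1 s
  exact ⟨D, fun k j N => by rw [geomCoeff_shift]; exact hD _ _⟩

theorem summable_coeff_mul_extension_shift (hq0 : 0 < q) (hq1 : q < 1) {n : ℕ}
    (s : Fin (n + 1) → ℂ) : Summable fun k => coeff (s 0) k * extension q (shift s k) := by
  obtain ⟨D, hD⟩ := exists_norm_geomCoeff_shift_le hq0 hq1 s
  exact Summable.of_norm_bounded (summable_shiftBound hq0 hq1 ‖s‖ D (n + 1)) fun k =>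
    norm_coeff_mul_extension_shift_le hq0 hq1 (norm_le_pi_norm s) (hD k)

theorem tsum_eq_tsum_succ_entry {n : ℕ} {f : (Fin (n + 1) → ℕ) → ℂ}
    (hf : ∀ m, m 0 = 0 → f m = 0) :
    ∑' m, f m = ∑' m : Fin (n + 1) → ℕ, f (Fin.cons (m 0 + 1) (Fin.tail m)) := by
  let φ : (Fin (n + 1) → ℕ) → (Fin (n + 1) → ℕ) := fun m => Fin.cons (m 0 + 1) (Fin.tail m)
  have hφ : Function.Injective φ := by
    intro x y h
    obtain ⟨h0, h1⟩ := Fin.cons_inj.1 h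
    rw [← Fin.cons_self_tail x, ← Fin.cons_self_tail y, Nat.succ_injective h0, h1]
  refine (hφ.tsum_eq fun m hm => ?_).symm
  have h0 : m 0 ≠ 0 := fun h => hm (hf m h)
  refine ⟨Fin.cons (m 0 - 1) (Fin.tail m), ?_⟩
  simp only [φ, Fin.cons_zero, Fin.tail_cons, Nat.sub_add_cancel (Nat.pos_of_ne_zero h0),
    Fin.cons_self_tail]

theorem summable_coeff_mul_expansionTerm_shift (hq0 : 0 < q) (hq1 : q < 1) {n : ℕ}
    (s : Fin (n + 1) → ℂ) : Summable fun x : ℕ × (Fin (n + 1) → ℕ) => coeff (s 0) x.1 *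
      expansionTerm q (shift s x.1) (geomCoeff q (shift s x.1)) x.2 := by
  obtain ⟨D, hD⟩ := exists_norm_geomCoeff_shift_le hq0 hq1 s
  have hb k := summable_norm_coeff_mul_expansionTerm hq0 hq1 (norm_le_pi_norm s) (hD k)
  have h1 : Summable fun k => ∑' m,
      ‖coeff (s 0) k * expansionTerm q (shift s k) (geomCoeff q (shift s k)) m‖ :=
    Summable.of_nonneg_of_le (fun k => tsum_nonneg fun _ => norm_nonneg _)
      (fun k => (hb k).2) (summable_shiftBound hq0 hq1 ‖s‖ D (n + 1))
  exact Summable.of_norm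
    ((summable_prod_of_nonneg fun x => norm_nonneg _).2 ⟨fun k => (hb k).1, h1⟩)

theorem tsum_coeff_mul_extension_shift (hq0 : 0 < q) (hq1 : q < 1) {n : ℕ}
    (s : Fin (n + 1) → ℂ) : ∑' k, coeff (s 0) k * extension q (shift s k) =
      ∑' m, (1 - (q : ℂ) ^ m 0) * expansionTerm q s (geomCoeff q s) m := by
  have hs := summable_coeff_mul_expansionTerm_shift hq0 hq1 s
  simp only [extension, ← tsum_mul_left]
  -- The left side only meets first exponents k+1+b ≥ 1; on the right, the terms with first exponent
  -- 0 vanish, so that index is lowered by one.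
  rw [tsum_tsum_eq_tsum_antidiagonal (F := fun k m => coeff (s 0) k *
    expansionTerm q (shift s k) (geomCoeff q (shift s k)) m) hs,
    tsum_eq_tsum_succ_entry (f := fun m => (1 - (q : ℂ) ^ m 0) *
      expansionTerm q s (geomCoeff q s) m) fun m hm => by rw [hm, pow_zero, sub_self, zero_mul]]
  refine tsum_congr fun m => ?_
  have h1 := sum_antidiagonal_choose_succ ((1 - q : ℝ) : ℂ) (m 0)
  rw [show 1 - (((1 - q : ℝ)) : ℂ) = q by push_cast; ring] at h1
  simp only [Fin.cons_zero]
  rw [← h1, Finset.sum_mul]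
  refine Finset.sum_congr rfl fun x hx => ?_
  rw [coeff_mul_expansionTerm_shift hq1, ← mem_antidiagonal.1 hx,
    show x.1 + x.2 + 1 = x.1 + 1 + x.2 by ring]

/-- Once the first geometric coefficient is cancelled, every remaining partial sum contains a + b;
only the two rising factorials distinguish a from b. -/
theorem one_sub_cpow_mul_expansionTerm {n : ℕ} (s : Fin (n + 2) → ℂ)
    {a : ℕ} (ha : 1 - (q : ℂ) ^ (s 0 + a) ≠ 0) (b : ℕ) (p : Fin n → ℕ) :
    (1 - (q : ℂ) ^ (s 0 + a)) * expansionTerm q s (geomCoeff q s)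
        (Fin.cons a (Fin.cons b p : Fin (n + 1) → ℕ)) =
      rising (s 0) a * rising (s 1) b * (((1 - q : ℝ) : ℂ) ^ (∑ i, merge s i) *
        (∏ i : Fin n, rising (s i.succ.succ) (p i)) *
        ((q : ℂ) ^ (∑ i, (merge s i + ((Fin.cons (a + b) p : Fin (n + 1) → ℕ) i : ℂ))) *
          ∏ j, geomCoeff q (merge s) j (pSum (Fin.cons (a + b) p : Fin (n + 1) → ℕ) j))) := by
  have h1 : ∑ i, merge s i = ∑ i, s i := by
    simp only [Fin.sum_univ_succ, merge, Fin.cons_zero, Fin.cons_succ, add_assoc]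
    rfl
  have h2 : ∑ i, (merge s i + ((Fin.cons (a + b) p : Fin (n + 1) → ℕ) i : ℂ)) =
      ∑ i, (s i + ((Fin.cons a (Fin.cons b p : Fin (n + 1) → ℕ) : Fin (n + 2) → ℕ) i : ℂ)) := by
    rw [Finset.sum_add_distrib, Finset.sum_add_distrib, h1]
    rw [sum_natCast_cons, sum_natCast_cons, sum_natCast_cons]
    push_cast
    ring
  have h3 (j : Fin (n + 1)) :
      geomCoeff q (merge s) j (pSum (Fin.cons (a + b) p : Fin (n + 1) → ℕ) j) =
      geomCoeff q s j.succ
        (pSum (Fin.cons a (Fin.cons b p : Fin (n + 1) → ℕ) : Fin (n + 2) → ℕ) j.succ) := by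
    rw [geomCoeff, geomCoeff, pSum_merge, pSum_cons_cons_succ]
  have h4 : geomCoeff q s 0
      (pSum (Fin.cons a (Fin.cons b p : Fin (n + 1) → ℕ) : Fin (n + 2) → ℕ) 0) =
      (1 - (q : ℂ) ^ (s 0 + a))⁻¹ := by
    have h5 : pSum s 0 = s 0 := by
      conv_lhs => rw [← Fin.cons_self_tail s]
      exact pSum_cons_zero _ _
    rw [geomCoeff, pSum_cons_zero, h5]
  simp only [h1, h2, h3, expansionTerm, Fin.prod_univ_succ (fun j => geomCoeff q s j _), h4]
  rw [Fin.prod_univ_succ (fun i => rising _ _), Fin.prod_univ_succ (fun i => rising _ _)]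
  simp only [Fin.cons_zero, Fin.cons_succ, Fin.succ_zero_eq_one, Fin.cons_one]
  have h6 := mul_inv_cancel₀ ha
  set X := 1 - (q : ℂ) ^ (s 0 + a)
  linear_combination (rising (s 0) a * rising (s 1) b * (((1 - q : ℝ) : ℂ) ^ (∑ i, s i) *
        (∏ i : Fin n, rising (s i.succ.succ) (p i)) *
        ((q : ℂ) ^ (∑ i, (s i +
          ((Fin.cons a (Fin.cons b p : Fin (n + 1) → ℕ) : Fin (n + 2) → ℕ) i : ℂ))) *
          ∏ j : Fin (n + 1), geomCoeff q s j.succ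
        (pSum (Fin.cons a (Fin.cons b p : Fin (n + 1) → ℕ) : Fin (n + 2) → ℕ) j.succ)))) * h6

theorem summable_one_sub_cpow_mul_expansionTerm (hq0 : 0 < q) (hq1 : q < 1) {n : ℕ}
    (s : Fin (n + 1) → ℂ) (w : ℂ) : Summable fun m : Fin (n + 1) → ℕ =>
      (1 - w * (q : ℂ) ^ m 0) * expansionTerm q s (geomCoeff q s) m := by
  refine Summable.of_norm_bounded
    ((summable_norm_expansionTerm_geomCoeff hq0 hq1 s).mul_left (1 + ‖w‖)) fun m => ?_
  rw [norm_mul]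
  gcongr
  refine (norm_sub_le _ _).trans ?_
  rw [norm_one, norm_mul, norm_pow, Complex.norm_real, Real.norm_of_nonneg hq0.le]
  gcongr
  exact mul_le_of_le_one_right (norm_nonneg _) (pow_le_one₀ hq0.le hq1.le)

theorem extension_merge (hq0 : 0 < q) (hq1 : q < 1) {n : ℕ} {s : Fin (n + 2) → ℂ}
    (hs : ∀ a : ℕ, 1 - (q : ℂ) ^ (s 0 + a) ≠ 0) : extension q (merge s) =
      ∑' m, (1 - (q : ℂ) ^ s 0 * (q : ℂ) ^ m 0) * expansionTerm q s (geomCoeff q s) m := by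
  have h1 := summable_one_sub_cpow_mul_expansionTerm hq0 hq1 s ((q : ℂ) ^ s 0)
  rw [← (consNat (n + 1)).summable_iff] at h1
  rw [← (consNat (n + 1)).tsum_eq]
  simp only [Function.comp_def, consNat_apply, Fin.cons_zero, ← cpow_add_natCast hq0] at h1 ⊢
  rw [h1.tsum_prod, tsum_tsum_eq_tsum_antidiagonal (F := fun a m => (1 - (q : ℂ) ^ (s 0 + a)) *
    expansionTerm q s (geomCoeff q s) (Fin.cons a m)) h1, extension]
  refine tsum_congr fun m => ?_
  rw [← Fin.cons_self_tail m]
  generalize m 0 = c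
  generalize Fin.tail m = p
  simp only [one_sub_cpow_mul_expansionTerm s (hs _), Fin.cons_zero, Fin.tail_cons]
  have h2 : ∀ x ∈ antidiagonal c, x.1 + x.2 = c := fun x hx => mem_antidiagonal.1 hx
  rw [Finset.sum_congr rfl fun x hx => by rw [h2 x hx], ← Finset.sum_mul,
    sum_antidiagonal_rising, expansionTerm, Fin.prod_univ_succ]
  simp only [Fin.cons_zero, Fin.cons_succ, merge]
  ring

theorem translation_of_ne (hq0 : 0 < q) (hq1 : q < 1) {n : ℕ} {s : Fin (n + 2) → ℂ}
    (hs : ∀ a : ℕ, 1 - (q : ℂ) ^ (s 0 + a) ≠ 0) : extension q (merge s) =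
      (q : ℂ) ^ s 0 * ∑' k, coeff (s 0) k * extension q (shift s k) +
        (1 - (q : ℂ) ^ s 0) * extension q s := by
  have h1 := summable_one_sub_cpow_mul_expansionTerm hq0 hq1 s 1
  have h2 := (summable_norm_expansionTerm_geomCoeff hq0 hq1 s).of_norm
  simp only [one_mul] at h1
  rw [extension_merge hq0 hq1 hs, tsum_coeff_mul_extension_shift hq0 hq1, extension,
    ← tsum_mul_left, ← tsum_mul_left, ← (h1.mul_left _).tsum_add (h2.mul_left _)]
  refine tsum_congr fun m => ?_
  ring

end Translation

/-! ### The translation formula at all holomorphic points, by continuity. -/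

section TranslationFormula

open Filter Topology

variable {q : ℝ}

theorem merge_add_smul {n : ℕ} (s : Fin (n + 2) → ℂ) (t : ℂ) :
    merge (s + t • (Fin.cons 1 (Fin.cons (-1) 0 : Fin (n + 1) → ℂ) : Fin (n + 2) → ℂ)) =
      merge s := by
  funext i
  refine Fin.cases ?_ (fun i => ?_) i
  · simp [merge]
    ring
  · simp [merge]

theorem continuous_shift {n : ℕ} (k : ℕ) :
    Continuous fun s : Fin (n + 1) → ℂ => shift s k := by
  unfold shift
  exact continuous_id.update 0 (by fun_prop)

theorem continuous_coeff (k : ℕ) : Continuous fun s => coeff s k := by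
  simp only [coeff_eq_rising]
  exact continuous_const.mul (differentiable_rising _).continuous

theorem eventually_one_sub_cpow_ne_zero (hq0 : 0 < q) (hq1 : q < 1) (w : ℂ) :
    ∀ᶠ t : ℝ in 𝓝[>] 0, ∀ a : ℕ, 1 - (q : ℂ) ^ (w + t + a) ≠ 0 := by
  -- For such t > 0, Re w + t lies strictly between consecutive integers, whereas a zero would force
  -- it to equal -a.
  have h1 : ∀ᶠ t : ℝ in 𝓝[>] 0, t < ⌊w.re⌋ + 1 - w.re := by
    refine mem_of_superset (Ioo_mem_nhdsGT (sub_pos.2 (Int.lt_floor_add_one w.re))) fun t ht => ht.2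
  filter_upwards [h1, self_mem_nhdsWithin] with t ht1 ht0 a h
  have h2 := congrArg Real.log (congrArg norm (sub_eq_zero.1 h))
  rw [Complex.norm_cpow_eq_rpow_re_of_pos hq0, norm_one, Real.log_one, Real.log_rpow hq0,
    zero_eq_mul, or_iff_left (Real.log_neg hq0 hq1).ne] at h2
  simp only [Complex.add_re, Complex.natCast_re, Complex.ofReal_re] at h2
  have h3 : (⌊w.re⌋ : ℝ) ≤ w.re := Int.floor_le _
  have h4 : (0 : ℝ) < t := ht0
  have h5 : ((⌊w.re⌋ : ℤ) : ℝ) < ((-a : ℤ) : ℝ) := by push_cast; linarith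
  have h6 : ((-a : ℤ) : ℝ) < ((⌊w.re⌋ + 1 : ℤ) : ℝ) := by push_cast; linarith
  have h7 := Int.cast_lt.1 h5
  have h8 := Int.cast_lt.1 h6
  omega

theorem continuousAt_tsum_coeff_mul_extension_shift (hq0 : 0 < q) (hq1 : q < 1) {n : ℕ}
    {s : Fin (n + 1) → ℂ} (hs : ∀ k, ContinuousAt (extension q) (shift s k)) :
    ContinuousAt (fun s : Fin (n + 1) → ℂ => ∑' k, coeff (s 0) k * extension q (shift s k)) s := by
  have hterm (k : ℕ) :
      ContinuousAt (fun s : Fin (n + 1) → ℂ => coeff (s 0) k * extension q (shift s k)) s := by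
    refine ((continuous_coeff k).comp (continuous_apply 0)).continuousAt.mul ?_
    exact ContinuousAt.comp (f := fun s : Fin (n + 1) → ℂ => shift s k) (hs k)
      (continuous_shift k).continuousAt
  obtain ⟨M, hM⟩ : ∃ M : ℕ, ∀ j, 0 < (pSum s j).re + M := exists_nat_pos_re_add _
  -- The finitely many terms with k < M may be near poles and are bounded by local continuity;
  -- beyond M all real parts are positive nearby and the uniform bound applies.
  let v : ℕ → ℝ := fun k => if k < M then ‖coeff (s 0) k * extension q (shift s k)‖ + 1
    else shiftBound q (‖s‖ + 1) (1 - q ^ (1 : ℝ))⁻¹ (n + 1) k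
  have hv : Summable v := by
    rw [← summable_nat_add_iff M]
    refine ((summable_nat_add_iff M).2 (summable_shiftBound hq0 hq1 (‖s‖ + 1)
      (1 - q ^ (1 : ℝ))⁻¹ (n + 1))).congr fun k => ?_
    simp [v]
  refine tendsto_tsum_of_dominated_convergence hv hterm ?_
  have h1 : ∀ᶠ z in 𝓝 s, ∀ k : Fin M, ‖coeff (z 0) k * extension q (shift z k)‖ <
      ‖coeff (s 0) k * extension q (shift s k)‖ + 1 := by
    refine eventually_all.2 fun k => ?_
    exact (hterm k).norm.eventually (gt_mem_nhds (lt_add_one _))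
  have h2 : ∀ᶠ z : Fin (n + 1) → ℂ in 𝓝 s, ∀ j, 0 < (pSum z j).re + (M : ℝ) := by
    refine eventually_all.2 fun j => ?_
    have h3 : Continuous fun z : Fin (n + 1) → ℂ => (pSum z j).re + M :=
      (Complex.continuous_re.comp (differentiable_pSum j).continuous).add continuous_const
    exact (h3.tendsto s).eventually (lt_mem_nhds (hM j))
  have h3 : ∀ᶠ z in 𝓝 s, ‖z‖ < ‖s‖ + 1 :=
    (continuous_norm.tendsto s).eventually (gt_mem_nhds (lt_add_one _))
  filter_upwards [h1, h2, h3] with z hz1 hz2 hz3 k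
  by_cases hk : k < M
  · simpa [v, hk] using (hz1 ⟨k, hk⟩).le
  · simp only [v, hk, if_false]
    refine norm_coeff_mul_extension_shift_le_of_re hq0 hq1
      (fun i => (norm_le_pi_norm z i).trans hz3.le) fun j => ?_
    have : (M : ℝ) ≤ k := by exact_mod_cast not_lt.1 hk
    linarith [hz2 j]

theorem translation (hq0 : 0 < q) (hq1 : q < 1) {n : ℕ} {s : Fin (n + 2) → ℂ}
    (h0 : ContinuousAt (extension q) s) (hs : ∀ k, ContinuousAt (extension q) (shift s k)) :
    extension q (merge s) =
      (q : ℂ) ^ s 0 * ∑' k, coeff (s 0) k * extension q (shift s k) +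
        (1 - (q : ℂ) ^ s 0) * extension q s := by
  have hq : (q : ℂ) ≠ 0 := by exact_mod_cast hq0.ne'
  -- The direction (1, -1, 0, …) keeps s_1 + s_2 fixed while moving s_1 off the exceptional values.
  let γ : ℝ → Fin (n + 2) → ℂ := fun t =>
    s + (t : ℂ) • (Fin.cons 1 (Fin.cons (-1) 0 : Fin (n + 1) → ℂ) : Fin (n + 2) → ℂ)
  have hγ0 (t : ℝ) : γ t 0 = s 0 + t := by simp [γ]
  have hγ : Tendsto γ (𝓝[>] 0) (𝓝 s) := by
    have h1 : Continuous γ := by fun_prop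
    have h2 := h1.tendsto 0
    simp only [γ, Complex.ofReal_zero, zero_smul, add_zero] at h2
    exact h2.mono_left nhdsWithin_le_nhds
  have hpow : ContinuousAt (fun z : Fin (n + 2) → ℂ => (q : ℂ) ^ z 0) s :=
    ContinuousAt.const_cpow (continuous_apply 0).continuousAt (Or.inl hq)
  have hlim := ((hpow.mul (continuousAt_tsum_coeff_mul_extension_shift hq0 hq1 hs)).add
    (((continuousAt_const (y := (1 : ℂ))).sub hpow).mul h0)).tendsto.comp hγ
  refine tendsto_nhds_unique (tendsto_const_nhds.congr' ?_) hlim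
  filter_upwards [eventually_one_sub_cpow_ne_zero hq0 hq1 (s 0)] with t ht
  rw [← merge_add_smul s t]
  exact translation_of_ne hq0 hq1 (s := γ t) fun a => by rw [hγ0]; exact ht a

end TranslationFormula

end QZetaStar

theorem mainTheorem10 (q : ℝ) (hq0 : 0 < q) (hq1 : q < 1) :
    ∃ Z : (r : ℕ) → (Fin r → ℂ) → ℂ,
      -- in every depth `r ≥ 1`, the series converges absolutely on `U_r`, and `Z r` is a
      -- meromorphic function on `ℂ^r`, holomorphic on `U_r`, that extends its sum
      (∀ r : ℕ, 1 ≤ r →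
        (∀ s ∈ QZetaStar.U r,
          Summable fun k : QZetaStar.StarIndex r => QZetaStar.starTerm q s k.1) ∧
        QZetaStar.IsMeromorphic (Z r) ∧
        AnalyticOnNhd ℂ (Z r) (QZetaStar.U r) ∧
        ∀ s ∈ QZetaStar.U r, Z r s = QZetaStar.zetaStar q s) ∧
      -- in every depth `r = n + 2 ≥ 2`
      ∀ n : ℕ,
        -- the series in the translation formula converges normally on the compact subsets of `U_r`
        (∀ K : Set (Fin (n + 2) → ℂ), IsCompact K → K ⊆ QZetaStar.U (n + 2) →
          QZetaStar.NormallyConvergentOn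
            (fun k s => QZetaStar.coeff (s 0) k * Z (n + 2) (QZetaStar.shift s k)) K) ∧
        -- the translation formula holds wherever all its members are holomorphic,
        -- in particular on `U_r`
        ∀ s : Fin (n + 2) → ℂ,
          AnalyticAt ℂ (Z (n + 1)) (QZetaStar.merge s) →
          AnalyticAt ℂ (Z (n + 2)) s →
          (∀ k : ℕ, AnalyticAt ℂ (Z (n + 2)) (QZetaStar.shift s k)) →
          (Summable fun k : ℕ =>
            QZetaStar.coeff (s 0) k * Z (n + 2) (QZetaStar.shift s k)) ∧
          Z (n + 1) (QZetaStar.merge s) =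
            (q : ℂ) ^ s 0 *
                ∑' k : ℕ, QZetaStar.coeff (s 0) k * Z (n + 2) (QZetaStar.shift s k) +
              (1 - (q : ℂ) ^ s 0) * Z (n + 2) s := by
  refine ⟨fun r => QZetaStar.extension q, fun r hr => ⟨fun s hs => ?_, ?_, fun s hs => ?_,
    fun s hs => ?_⟩, fun n => ⟨fun K hK hKU => ?_, fun s _ h0 h1 => ⟨?_, ?_⟩⟩⟩
  · exact QZetaStar.summable_starTerm hq0 hq1 hs
  · exact QZetaStar.isMeromorphic_extension hq0 hq1 hr
  · exact QZetaStar.analyticAt_extension hq0 hq1 hs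
  · exact QZetaStar.extension_eq_zetaStar hq0 hq1 hs
  · obtain ⟨R, hR⟩ := hK.isBounded.exists_norm_le
    refine ⟨_, QZetaStar.summable_shiftBound hq0 hq1 R (1 - q ^ (1 : ℝ))⁻¹ (n + 2),
      fun k s hs => ?_⟩
    exact QZetaStar.norm_coeff_mul_extension_shift_le_of_re hq0 hq1
      (fun i => (norm_le_pi_norm s i).trans (hR s hs))
      -- On `U` the partial sums already have positive real part, so the uniform bound holds from k
      -- = 0 on.
      fun j => add_nonneg (hKU hs j).le k.cast_nonneg
  · exact QZetaStar.summable_coeff_mul_extension_shift hq0 hq1 s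
  · exact QZetaStar.translation hq0 hq1 h0.continuousAt fun k => (h1 k).continuousAt
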